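/- Let $\Sigma=\{0,1\}$ and let $\Sigma^*$ be the set of non-empty finite strings over $\Sigma$. A promise problem is a map $\phi$ from $\Sigma^*$ to the set $\{\{0\},\{1\},\Sigma\}$ of non-empty subsets of $\Sigma$; its dual $\lnot\phi$ is given by $(\lnot\phi)(s)=\{1-b : b\in\phi(s)\}$. Write $\phi_1\propto\phi_2$ (strong reduction) if there is $\mu:\Sigma^*\to\Sigma^*$, computable by a Turing machine in time polynomial in the length of the input, with $\phi_1(s)\supseteq\phi_2(\mu(s))$ for all $s\in\Sigma^*$; write $[\phi]=\{\psi : \psi\propto\phi\}$ and $\lnot[\phi]=[\lnot\phi]$. Functions $f:\Sigma^m\to\Sigma$ and $f:\Sigma^m\times\Sigma^{m'}\to\Sigma$ with $m\ge 1$, $m'\ge 0$ are encoded as strings by the numbers $m$ (and $m'$) in unary followed by a Boolean expression for $f$ with the operators $\land,\lor,\lnot$, written in prefix notation with the variables numbered in unary. Let $\mathrm{SAT}(f)=\{1\}$ if $f(x)=1$ for some $x$, and $\{0\}$ otherwise. Let $\mathrm{MaxVAL}(f)=\{x_1\}$, where $x$ is the lexicographically greatest string with $f(x)=1$ ($x_1$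 being the most significant bit), if there is an $x$ with $f(x)=1$, and $\mathrm{MaxVAL}(f)=\Sigma$ otherwise. Let $\mathrm{UVAL}_2(f)=\{x_1\}$ if there is exactly one $x$ such that $f(x,y)=1$ for all $y$, this $x$ being meant, and $\mathrm{UVAL}_2(f)=\Sigma$ otherwise. A string that encodes no function has the value $\{0\}$ under $\mathrm{SAT}$, and $\Sigma$ under $\mathrm{MaxVAL}$ and $\mathrm{UVAL}_2$. Theorem. (i) $\lnot[\mathrm{UVAL}_2]=[\mathrm{UVAL}_2]$. (ii) $\mathrm{MaxVAL}\propto\mathrm{UVAL}_2$. More precisely, there is a strong reduction $\mu$ of $\mathrm{MaxVAL}$ to $\mathrm{UVAL}_2$ that maps every code of an $f:\Sigma^m\to\Sigma$ to a code of the function $g:\Sigma^m\times\Sigma^{m(m-1)/2}\to\Sigma$ given by $$g(x,y)=f(x)\land\bigwedge_{i=1}^m\bigl(x_i\lor\lnot f(x_1,\ldots,x_{i-1},1,y_{i,i+1},\ldots,y_{i,m})\bigr),$$ where the bits of $y$ are indexed, in some order depending only on $m$, by the pairs $(i,j)$ with $1\le i<j\le m$; and for every $x\in\Sigma^m$, $g(x,y)=1$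 holds for all $y$ if and only if $x$ is the lexicographically greatest string with $f(x)=1$. (iii) $\mathrm{SAT}\propto\mathrm{UVAL}_2$. -/

import Mathlib

namespace PromiseHierarchy

/-- The set of finite non-empty strings over the alphabet `{0, 1}`. -/
abbrev Str : Type := {s : List Bool // s ≠ []}

/-- The non-empty subsets of `{0, 1}`: the possible sets of valid answers. -/
abbrev Answers : Type := {S : Set Bool // S.Nonempty}

/-- The answer set `{0, 1}`, for which every answer is valid. -/
def anyAnswer : Answers := ⟨Set.univ, Set.univ_nonempty⟩

/-- The answer set `{b}`. -/
def onlyAnswer (b : Bool) : Answers := ⟨{b}, Set.singleton_nonempty b⟩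

/-- Negation of answer sets: `{0} ↦ {1}`, `{1} ↦ {0}`, `{0, 1} ↦ {0, 1}`. -/
def Answers.neg (S : Answers) : Answers :=
  ⟨(fun b : Bool => !b) '' S.1, S.2.image _⟩

/-- The answer set that is `S` if the promise `P` holds, and `{0, 1}` otherwise. -/
def promise (P : Prop) (S : Set Bool) (h : P → S.Nonempty) : Answers :=
  ⟨{b | P → b ∈ S}, by
    by_cases hP : P
    · obtain ⟨b, hb⟩ := h hP
      exact ⟨b, fun _ => hb⟩
    · exact ⟨true, fun hP' => absurd hP' hP⟩⟩

/-- A promise problem assigns to every string its non-empty set of valid answers. -/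
abbrev PromiseProblem : Type := Str → Answers

/-- The dual promise problem. -/
def dual (φ : PromiseProblem) : PromiseProblem := fun s => (φ s).neg

/-- `μ` is computed by a Turing machine in time polynomial in the length of the input. -/
def PolyTime (μ : Str → Str) : Prop :=
  Nonempty (Turing.TM2ComputableInPolyTime
    (Subtype.val : Str → List Bool) (Subtype.val : Str → List Bool) μ)

/-- `μ` is a strong (many-one, Karp) reduction of `φ₁` to `φ₂`. -/
def IsStrongReduction (μ : Str → Str) (φ₁ φ₂ : PromiseProblem) : Prop :=
  PolyTime μ ∧ ∀ s, (φ₂ (μ s)).1 ⊆ (φ₁ s).1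

/-- Strong reducibility. -/
def StronglyReduces (φ₁ φ₂ : PromiseProblem) : Prop :=
  ∃ μ : Str → Str, IsStrongReduction μ φ₁ φ₂

infix:50 " ∝ " => StronglyReduces

/-- The strong closure of `φ₂`: all promise problems that strongly reduce to it. -/
def strongClosure (φ₂ : PromiseProblem) : Set PromiseProblem := {φ₁ | φ₁ ∝ φ₂}

/-- Boolean expressions in variables indexed by `V`. -/
inductive BExpr (V : Type) : Type
  | var (v : V) : BExpr V
  | not (e : BExpr V) : BExpr V
  | and (e₁ e₂ : BExpr V) : BExpr V
  | or (e₁ e₂ : BExpr V) : BExpr V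

/-- The Boolean function denoted by an expression. -/
def BExpr.eval {V : Type} : BExpr V → (V → Bool) → Bool
  | .var v, a => a v
  | .not e, a => !(e.eval a)
  | .and e₁ e₂, a => e₁.eval a && e₂.eval a
  | .or e₁ e₂, a => e₁.eval a || e₂.eval a

/-- The number `k` in self-delimiting unary: `k` ones and a zero. -/
def unary (k : ℕ) : List Bool := List.replicate k true ++ [false]

/-- Expressions as bit strings, in prefix notation; `num v` is the number of the variable `v`. -/
def BExpr.bits {V : Type} (num : V → ℕ) : BExpr V → List Bool
  | .var v => false :: false :: unary (num v)
  | .not e => false :: true :: e.bits num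
  | .and e₁ e₂ => true :: false :: (e₁.bits num ++ e₂.bits num)
  | .or e₁ e₂ => true :: true :: (e₁.bits num ++ e₂.bits num)

theorem unary_append_inj {k l : ℕ} {s t : List Bool} (h : unary k ++ s = unary l ++ t) :
    k = l ∧ s = t := by
  induction k generalizing l with
  | zero => cases l <;> simp_all [unary, List.replicate_succ]
  | succ k ih =>
    cases l with
    | zero => simp [unary, List.replicate_succ] at h
    | succ l =>
      have h' : unary k ++ s = unary l ++ t := by
        simpa [unary, List.replicate_succ] using h
      exact ⟨congrArg _ (ih h').1, (ih h').2⟩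

theorem BExpr.bits_append_inj {V : Type} {num : V → ℕ} (hn : Function.Injective num)
    {e e' : BExpr V} {s t : List Bool} (h : e.bits num ++ s = e'.bits num ++ t) :
    e = e' ∧ s = t := by
  induction e generalizing e' s t with
  | var v =>
    cases e' <;> simp only [bits, List.cons_append, List.cons.injEq, reduceCtorEq, false_and,
      and_false, true_and] at h
    obtain ⟨h1, h2⟩ := unary_append_inj h
    exact ⟨congrArg _ (hn h1), h2⟩
  | not e ih =>
    cases e' <;> simp only [bits, List.cons_append, List.cons.injEq, reduceCtorEq, false_and,
      and_false, true_and] at h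
    obtain ⟨h1, h2⟩ := ih h
    exact ⟨congrArg _ h1, h2⟩
  | and e₁ e₂ ih₁ ih₂ =>
    cases e' <;> simp only [bits, List.cons_append, List.cons.injEq, reduceCtorEq, false_and,
      and_false, true_and, List.append_assoc] at h
    obtain ⟨h1, h2⟩ := ih₁ h
    obtain ⟨h3, h4⟩ := ih₂ h2
    exact ⟨by rw [h1, h3], h4⟩
  | or e₁ e₂ ih₁ ih₂ =>
    cases e' <;> simp only [bits, List.cons_append, List.cons.injEq, reduceCtorEq, false_and,
      and_false, true_and, List.append_assoc] at h
    obtain ⟨h1, h2⟩ := ih₁ h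
    obtain ⟨h3, h4⟩ := ih₂ h2
    exact ⟨by rw [h1, h3], h4⟩

/-- An instance of a level 1 problem: an expression for `f(x)` with `x` of length `m ≥ 1`. -/
structure Inst₁ : Type where
  (m : ℕ)
  (pos : 0 < m)
  (f : BExpr (Fin m))

/-- An instance of a level 2 problem: an expression for `f(x, y)` with `x` of length `m ≥ 1`
and `y` of length `m' ≥ 0`. -/
structure Inst₂ : Type where
  (m : ℕ)
  (m' : ℕ)
  (pos : 0 < m)
  (f : BExpr (Fin m ⊕ Fin m'))

/-- The code of an instance: `m` in unary, then the expression. -/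
def Inst₁.code (I : Inst₁) : Str :=
  ⟨unary I.m ++ I.f.bits (fun i : Fin I.m => (i : ℕ)), by simp [unary]⟩

/-- The variables of `f(x, y)` are numbered with those of `x` first. -/
def num₂ (m m' : ℕ) : Fin m ⊕ Fin m' → ℕ :=
  Sum.elim (fun i => (i : ℕ)) (fun j => m + (j : ℕ))

/-- The code of an instance: `m` and `m'` in unary, then the expression. -/
def Inst₂.code (I : Inst₂) : Str :=
  ⟨unary I.m ++ (unary I.m' ++ I.f.bits (num₂ I.m I.m')), by simp [unary]⟩

theorem BExpr.bits_injective {V : Type} {num : V → ℕ} (hn : Function.Injective num) :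
    Function.Injective (BExpr.bits num) := fun e e' h =>
  (BExpr.bits_append_inj (e := e) (e' := e') (s := []) (t := []) hn (by rw [h])).1

theorem Inst₁.code_injective : Function.Injective Inst₁.code := by
  rintro ⟨m, hm, f⟩ ⟨n, hn, g⟩ h
  obtain ⟨rfl, h2⟩ := unary_append_inj (congrArg Subtype.val h)
  obtain rfl := BExpr.bits_injective (Fin.val_injective (n := m)) h2
  rfl

theorem num₂_injective (m m' : ℕ) : Function.Injective (num₂ m m') := by
  rintro (⟨i, hi⟩ | ⟨i, hi⟩) (⟨j, hj⟩ | ⟨j, hj⟩) h <;>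
    simp only [num₂, Sum.elim_inl, Sum.elim_inr] at h <;> first | omega | (simp; omega)

theorem Inst₂.code_injective : Function.Injective Inst₂.code := by
  rintro ⟨m, m', hm, f⟩ ⟨n, n', hn, g⟩ h
  obtain ⟨rfl, h2⟩ := unary_append_inj (congrArg Subtype.val h)
  obtain ⟨rfl, h3⟩ := unary_append_inj h2
  obtain rfl := BExpr.bits_injective (num₂_injective m m') h3
  rfl

/-- `x` is the lexicographically greatest string with `f(x) = 1` (the first bit is the most
significant). -/
def IsMaxSat {m : ℕ} (f : (Fin m → Bool) → Bool) (x : Fin m → Bool) : Prop :=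
  IsGreatest {z : Lex (Fin m → Bool) | f (ofLex z) = true} (toLex x)

theorem exists_isMaxSat {m : ℕ} {f : (Fin m → Bool) → Bool} (h : ∃ x, f x = true) :
    ∃ x, IsMaxSat f x := by
  obtain ⟨x, hx⟩ := h
  obtain ⟨z, hz, hz'⟩ := Set.exists_max_image
    {z : Lex (Fin m → Bool) | f (ofLex z) = true} id
    (Set.Finite.subset (Set.finite_univ (α := Fin m → Bool)) (fun _ _ => trivial))
    ⟨toLex x, hx⟩
  exact ⟨ofLex z, hz, hz'⟩

/-- The first bit of the greatest `x` with `f(x) = 1`, on the promise that there is some `x`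
with `f(x) = 1`. -/
def maxVal {m : ℕ} (hm : 0 < m) (f : (Fin m → Bool) → Bool) : Answers :=
  promise (∃ x, f x = true) {b | ∃ x, IsMaxSat f x ∧ x ⟨0, hm⟩ = b} (fun h =>
    let ⟨x, hx⟩ := exists_isMaxSat h
    ⟨x ⟨0, hm⟩, x, hx, rfl⟩)

/-- The first bit of the unique `x` such that `f(x, y) = 1` for all `y`, on the promise that
there is exactly one such `x`. -/
def uval₂ {m m' : ℕ} (hm : 0 < m) (f : (Fin m → Bool) → (Fin m' → Bool) → Bool) : Answers :=
  promise (∃! x, ∀ y, f x y = true) {b | ∃ x, (∀ y, f x y = true) ∧ x ⟨0, hm⟩ = b} (fun h =>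
    let ⟨x, hx, _⟩ := h
    ⟨x ⟨0, hm⟩, x, hx, rfl⟩)

open Classical in
/-- The (non-promise) satisfiability problem; a string that is not a code gets the answer `0`. -/
noncomputable def SAT : PromiseProblem :=
  Function.extend Inst₁.code (fun I => onlyAnswer (decide (∃ x, I.f.eval x = true)))
    (fun _ => onlyAnswer false)

/-- `MaxVAL`; for a string that is not a code nothing is promised. -/
noncomputable def MaxVAL : PromiseProblem :=
  Function.extend Inst₁.code (fun I => maxVal I.pos I.f.eval) (fun _ => anyAnswer)

/-- `UVAL₂`; for a string that is not a code nothing is promised. -/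
noncomputable def UVAL₂ : PromiseProblem :=
  Function.extend Inst₂.code (fun I => uval₂ I.pos (fun x y => I.f.eval (Sum.elim x y)))
    (fun _ => anyAnswer)

theorem MaxVAL_code (I : Inst₁) : MaxVAL I.code = maxVal I.pos I.f.eval :=
  Inst₁.code_injective.extend_apply _ _ I

theorem UVAL₂_code (I : Inst₂) :
    UVAL₂ I.code = uval₂ I.pos (fun x y => I.f.eval (Sum.elim x y)) :=
  Inst₂.code_injective.extend_apply _ _ I

/-- The index set of the variables `y_{i,j}` with `i < j`. -/
abbrev Pairs (m : ℕ) : Type := {p : Fin m × Fin m // p.1 < p.2}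

/-- The string `(x_1, …, x_{i-1}, 1, y_{i,i+1}, …, y_{i,m})`. -/
def spliced {m : ℕ} (x : Fin m → Bool) (y : Pairs m → Bool) (i : Fin m) : Fin m → Bool :=
  fun j => if h : i < j then y ⟨(i, j), h⟩ else if j = i then true else x j

/-- The function
`g(x, y) = f(x) ∧ ⋀ i, (x_i ∨ ¬ f(x_1, …, x_{i-1}, 1, y_{i,i+1}, …, y_{i,m}))`. -/
def maxFormula {m : ℕ} (f : (Fin m → Bool) → Bool) (x : Fin m → Bool) (y : Pairs m → Bool) :
    Bool :=
  f x && decide (∀ i, (x i || !(f (spliced x y i))) = true)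

end PromiseHierarchy

/-!
Negating the first variable of `f(x, y)` permutes the `x` with `∀ y, f(x, y) = 1` and flips their
first bit; hence `UVAL₂` is self-dual. If `f(x) = 1`, then `x` is not the greatest solution if and
only if a greater one arises by changing some bit `x_i = 0` to `1` and choosing the bits after it
arbitrarily. The formula `g` says that this is impossible, so that the only `x` with
`∀ y, g(x, y) = 1` is the greatest solution, and `MaxVAL` reduces to `UVAL₂`. The greatest `(z, x)`
with `¬ z ∨ f(x)` begins with `1` if and only if `f` is satisfiable, so that `SAT` reduces to
`MaxVAL`.

The time bounds come from a language of programs whose registers are stacks and whose loops run at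
most `n + 1` rounds, where `n` is the length of the input. With the total size of the registers as
potential, the amortised cost of a program is a polynomial in `n`, so that the compiled machine runs
in polynomial time. The reductions rewrite an expression token by token, replacing each variable by
a short expression. Strings that are not codes are replaced by the code of a fixed instance; they
are recognized by counting the expressions that are still to come.
-/

namespace PromiseHierarchy

open Turing

section Machines

open StateTransition

/-! ### Composition of machines -/

section StepsTo

variable {σ τ : Type*} {f : σ → Option σ}

/-- `StepsTo f t a b`: exactly `t` steps of the transition function `f` lead from `a` to `b`. -/
def StepsTo (f : σ → Option σ) : ℕ → σ → σ → Prop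
  | 0, a, b => a = b
  | t + 1, a, b => ∃ c, f a = some c ∧ StepsTo f t c b

theorem StepsTo.head {t : ℕ} {a b c : σ} (h : f a = some b) (h' : StepsTo f t b c) :
    StepsTo f (t + 1) a c :=
  ⟨b, h, h'⟩

theorem StepsTo.single {a b : σ} (h : f a = some b) : StepsTo f 1 a b :=
  ⟨b, h, rfl⟩

theorem StepsTo.trans {s t : ℕ} {a b c : σ} (h : StepsTo f s a b) (h' : StepsTo f t b c) :
    StepsTo f (s + t) a c := by
  induction s generalizing a with
  | zero => obtain rfl := h; simpa using h'
  | succ s ih =>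
    obtain ⟨d, hd, h⟩ := h
    rw [Nat.succ_add]
    exact .head hd (ih h)

theorem stepsTo_iff {t : ℕ} {a b : σ} :
    StepsTo f t a b ↔ (flip bind f)^[t] (some a) = some b := by
  induction t generalizing a with
  | zero => simp [StepsTo]
  | succ t ih =>
    rw [Function.iterate_succ_apply]
    change _ ↔ (flip bind f)^[t] (f a) = some b
    cases h : f a with
    | none =>
      have hnone : (flip bind f)^[t] none = none := Function.iterate_fixed rfl t
      rw [hnone]
      simp [StepsTo, h]
    | some c => simp [StepsTo, h, ih]

theorem StepsTo.map {g : τ → Option τ} {e : σ → τ}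
    (he : ∀ a b, f a = some b → g (e a) = some (e b)) {t : ℕ} {a b : σ} (h : StepsTo f t a b) :
    StepsTo g t (e a) (e b) := by
  induction t generalizing a with
  | zero => exact congrArg e h
  | succ t ih => exact let ⟨_, hc, h⟩ := h; .head (he _ _ hc) (ih h)

theorem StepsTo.le_add_mul {w : σ → ℕ} {C : ℕ} (hw : ∀ a b, f a = some b → w b ≤ w a + C)
    {t : ℕ} {a b : σ} (h : StepsTo f t a b) : w b ≤ w a + C * t := by
  induction t generalizing a with
  | zero => exact (congrArg w h).ge
  | succ t ih =>
    obtain ⟨c, hc, h⟩ := h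
    linarith [hw a c hc, ih h]

theorem stepsTo_foldl {α β : Type*} {c : List α → β → σ} {d : β → σ} {g : β → α → β}
    (hcons : ∀ a s x, f (c (a :: s) x) = some (c s (g x a)))
    (hnil : ∀ x, f (c [] x) = some (d x)) (s : List α) (x : β) :
    StepsTo f (s.length + 1) (c s x) (d (s.foldl g x)) := by
  induction s generalizing x with
  | nil => exact .single (hnil x)
  | cons a s ih => exact .head (hcons a s x) (ih _)

end StepsTo

theorem eval_le_eval (p : Polynomial ℕ) {m n : ℕ} (h : m ≤ n) : p.eval m ≤ p.eval n := by
  simp only [Polynomial.eval_eq_sum_range]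
  gcongr

section PushCount

variable {K Λ σ : Type} [DecidableEq K] {Γ : K → Type}

/-- An upper bound for the number of symbols that a statement pushes. -/
def pushCount : TM2.Stmt Γ Λ σ → ℕ
  | .push _ _ q => pushCount q + 1
  | .peek _ _ q => pushCount q
  | .pop _ _ q => pushCount q
  | .load _ q => pushCount q
  | .branch _ q₁ q₂ => max (pushCount q₁) (pushCount q₂)
  | .goto _ => 0
  | .halt => 0

theorem length_stk_stepAux_le (q : TM2.Stmt Γ Λ σ) (v : σ) (S : ∀ k, List (Γ k)) (k : K) :
    ((TM2.stepAux q v S).stk k).length ≤ (S k).length + pushCount q := by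
  induction q generalizing v S with
  | push j f _ ih =>
    refine (ih _ _).trans ?_
    obtain rfl | h := eq_or_ne k j
    · simp only [Function.update_self, List.length_cons, pushCount]
      omega
    · simp only [Function.update_of_ne h, pushCount]
      omega
  | peek _ _ _ ih => exact ih _ _
  | pop j f _ ih =>
    refine (ih _ _).trans ?_
    obtain rfl | h := eq_or_ne k j
    · simp [pushCount]
    · simp [Function.update_of_ne h, pushCount]
  | load _ _ ih => exact ih _ _
  | branch f q₁ q₂ ih₁ ih₂ =>
    have h₁ := ih₁ v S
    have h₂ := ih₂ v S
    rw [TM2.stepAux, pushCount]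
    cases f v <;> simp only [cond_true, cond_false] <;> omega
  | goto => simp [pushCount, TM2.stepAux]
  | halt => simp [pushCount, TM2.stepAux]

end PushCount

section FinTM2

variable (M : FinTM2)

theorem initList_eq (s : List (M.Γ M.k₀)) :
    initList M s = ⟨some M.main, M.initialState, Function.update (fun _ => []) M.k₀ s⟩ := by
  simp only [initList]
  congr 1
  funext k
  by_cases h : k = M.k₀
  · subst h; simp
  · simp [h]

theorem haltList_eq (s : List (M.Γ M.k₁)) :
    haltList M s = ⟨none, M.initialState, Function.update (fun _ => []) M.k₁ s⟩ := by
  simp only [haltList]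
  congr 1
  funext k
  by_cases h : k = M.k₁
  · subst h; simp
  · simp [h]

theorem exists_length_le_of_stepsTo_haltList : ∃ C, ∀ t s s',
    StepsTo M.step t (initList M s) (haltList M s') → s'.length ≤ s.length + C * t := by
  classical
  have := M.ΛFin
  refine ⟨Finset.univ.sup fun l => pushCount (M.m l), fun t s s' h => ?_⟩
  have hw : ∀ a b : M.Cfg, M.step a = some b →
      (b.stk M.k₁).length ≤ (a.stk M.k₁).length + Finset.univ.sup fun l => pushCount (M.m l) := by
    rintro ⟨_ | l, v, S⟩ b hb
    · cases hb
    · obtain rfl : TM2.stepAux (M.m l) v S = b := Option.some.inj hb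
      grw [length_stk_stepAux_le, Finset.le_sup (f := fun l => pushCount (M.m l))
        (Finset.mem_univ l)]
  have hs : ((initList M s).stk M.k₁).length ≤ s.length := by
    rw [initList_eq]
    by_cases h : M.k₁ = M.k₀
    · rw [h]; simp
    · simp [Function.update_of_ne h]
  have hs' : s'.length = ((haltList M s').stk M.k₁).length := by simp [haltList_eq]
  have h := h.le_add_mul hw
  omega

end FinTM2

namespace Pipeline

variable (M : Bool → FinTM2)

/-- The stacks of the pipeline from `M false` to `M true`: those of both machines, and `none` for
the transfer. -/
abbrev Stk : Type := Option (Σ i, (M i).K)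

/-- The stack alphabets of the pipeline. -/
abbrev Alph : Stk M → Type
  | none => (M true).Γ (M true).k₀
  | some k => (M k.1).Γ k.2

/-- The labels of the pipeline: `inl false` and `inl true` move the output of `M false` onto the
transfer stack and from there into `M true`, `inr` holds the labels of both machines. -/
abbrev Lbl : Type := Bool ⊕ Σ i, (M i).Λ

/-- The states of the pipeline: those of both machines, and the symbol being transferred. -/
abbrev State : Type := (∀ i, (M i).σ) × Option ((M true).Γ (M true).k₀)

variable {M}

/-- The statements of `M i`, where halting starts the transfer if `i = false`. -/
def lift (i : Bool) : TM2.Stmt (M i).Γ (M i).Λ (M i).σ → TM2.Stmt (Alph M) (Lbl M) (State M)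
  | .push k f q => .push (some ⟨i, k⟩) (fun v => f (v.1 i)) (lift i q)
  | .peek k f q =>
    .peek (some ⟨i, k⟩) (fun v o => (Function.update v.1 i (f (v.1 i) o), v.2)) (lift i q)
  | .pop k f q =>
    .pop (some ⟨i, k⟩) (fun v o => (Function.update v.1 i (f (v.1 i) o), v.2)) (lift i q)
  | .load f q => .load (fun v => (Function.update v.1 i (f (v.1 i)), v.2)) (lift i q)
  | .branch f q₁ q₂ => .branch (fun v => f (v.1 i)) (lift i q₁) (lift i q₂)
  | .goto f => .goto fun v => .inr ⟨i, f (v.1 i)⟩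
  | .halt => if i then .halt else .goto fun _ => .inl false

/-- The stack contents of the pipeline. -/
def stk (S : ∀ i k, List ((M i).Γ k)) (w : List (Alph M none)) : ∀ k, List (Alph M k)
  | none => w
  | some k => S k.1 k.2

@[simp]
theorem stk_some (S : ∀ i k, List ((M i).Γ k)) (w : List (Alph M none)) (i : Bool) (k : (M i).K) :
    stk S w (some ⟨i, k⟩) = S i k :=
  rfl

@[simp]
theorem stk_none (S : ∀ i k, List ((M i).Γ k)) (w : List (Alph M none)) : stk S w none = w :=
  rfl

theorem update_stk_none (S : ∀ i k, List ((M i).Γ k)) (w w' : List (Alph M none)) :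
    Function.update (stk S w) none w' = stk S w' := by
  funext j
  cases j <;> simp [stk]

theorem update_stk_some (S : ∀ i k, List ((M i).Γ k)) (w : List (Alph M none)) (i : Bool)
    (k : (M i).K) (s : List ((M i).Γ k)) :
    Function.update (stk S w) (some ⟨i, k⟩) s =
      stk (Function.update S i (Function.update (S i) k s)) w := by
  funext j
  rcases j with _ | ⟨j, k'⟩
  · simp [stk]
  obtain rfl | h := eq_or_ne j i
  · obtain rfl | h := eq_or_ne k' k <;> simp [stk, *]
  · have hne : some (⟨j, k'⟩ : Σ i, (M i).K) ≠ some ⟨i, k⟩ := by simp [h]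
    simp [stk, h, hne]

/-- The configuration of the pipeline in which `M i` is running and has the label `l`. -/
def embed (i : Bool) (l : Option (M i).Λ) (v : ∀ i, (M i).σ) (S : ∀ i k, List ((M i).Γ k)) :
    TM2.Cfg (Alph M) (Lbl M) (State M) where
  l := l.elim (if i then none else some (.inl false)) fun l => some (.inr ⟨i, l⟩)
  var := (v, none)
  stk := stk S []

theorem stepAux_lift (i : Bool) (q : TM2.Stmt (M i).Γ (M i).Λ (M i).σ) (v : ∀ i, (M i).σ)
    (S : ∀ i k, List ((M i).Γ k)) {c : TM2.Cfg (M i).Γ (M i).Λ (M i).σ}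
    (hc : TM2.stepAux q (v i) (S i) = c) :
    TM2.stepAux (lift i q) (v, none) (stk S []) =
      embed i c.l (Function.update v i c.var) (Function.update S i c.stk) := by
  subst hc
  induction q generalizing v S with
  | push k f q ih =>
    simpa [lift, TM2.stepAux, update_stk_some] using
      ih v (Function.update S i (Function.update (S i) k (f (v i) :: S i k)))
  | peek k f q ih =>
    simpa [lift, TM2.stepAux] using ih (Function.update v i (f (v i) (S i k).head?)) S
  | pop k f q ih =>
    simpa [lift, TM2.stepAux, update_stk_some] using
      ih (Function.update v i (f (v i) (S i k).head?))
        (Function.update S i (Function.update (S i) k (S i k).tail))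
  | load f q ih => simpa [lift, TM2.stepAux] using ih (Function.update v i (f (v i))) S
  | branch f q₁ q₂ ih₁ ih₂ =>
    rw [lift, TM2.stepAux, TM2.stepAux]
    cases f (v i)
    · exact ih₂ v S
    · exact ih₁ v S
  | goto f => simp [lift, TM2.stepAux, embed]
  | halt => cases i <;> simp [lift, TM2.stepAux, embed]

/-- The configuration of the pipeline in which `M i` has the configuration `c` and the other machine
is idle. -/
def running (i : Bool) (c : TM2.Cfg (M i).Γ (M i).Λ (M i).σ) :
    TM2.Cfg (Alph M) (Lbl M) (State M) :=
  embed i c.l (Function.update (fun i => (M i).initialState) i c.var)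
    (Function.update (fun _ _ => []) i c.stk)

/-- The contents of the stacks when only the stack `k` of `M i` is non-empty. -/
def only (i : Bool) (k : (M i).K) (s : List ((M i).Γ k)) : ∀ j k, List ((M j).Γ k) :=
  Function.update (fun _ _ => []) i (Function.update (fun _ => []) k s)

@[simp]
theorem only_self (i : Bool) (k : (M i).K) (s : List ((M i).Γ k)) : only i k s i k = s := by
  simp [only]

theorem stk_only_nil (i : Bool) (k : (M i).K) (s : List ((M i).Γ k)) :
    stk (only i k s) [] =
      Function.update (β := fun k => List (Alph M k)) (fun _ => []) (some ⟨i, k⟩) s := by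
  have h : stk (fun _ _ => []) [] = fun k => ([] : List (Alph M k)) := by
    funext j
    cases j <;> rfl
  rw [← h, update_stk_some, only]

theorem update_stk_only (i : Bool) (k : (M i).K) (s s' : List ((M i).Γ k))
    (w : List (Alph M none)) :
    Function.update (stk (only i k s) w) (some ⟨i, k⟩) s' = stk (only i k s') w := by
  rw [update_stk_some]
  simp [only]

/-- The configuration of the pipeline during a transfer: the stack `k` of `M i` contains `s`, the
transfer stack contains `w`. -/
def transferring (b : Bool) (i : Bool) (k : (M i).K) (s : List ((M i).Γ k))
    (w : List ((M true).Γ (M true).k₀)) : TM2.Cfg (Alph M) (Lbl M) (State M) :=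
  ⟨some (.inl b), (fun i => (M i).initialState, none), stk (only i k s) w⟩

theorem transferring_nil (b i j : Bool) (k : (M i).K) (l : (M j).K)
    (w : List ((M true).Γ (M true).k₀)) :
    transferring b i k [] w = transferring b j l [] w := by
  simp [transferring, only]

theorem running_haltList (s : List ((M false).Γ (M false).k₁)) :
    running false (haltList (M false) s) = transferring false false (M false).k₁ s [] := by
  rw [haltList_eq]
  simp [running, embed, transferring, only]

variable [Inhabited ((M true).Γ (M true).k₀)]
  (e : (M false).Γ (M false).k₁ → (M true).Γ (M true).k₀)

/-- The statements of the pipeline, in which the output of `M false` is renamed by `e`. -/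
def stmt : Lbl M → TM2.Stmt (Alph M) (Lbl M) (State M)
  | .inl false =>
    .pop (some ⟨false, (M false).k₁⟩) (fun v o => (v.1, o.map e))
      (.branch (fun v => v.2.isSome)
        (.push none (fun v => v.2.getD default)
          (.load (fun v => (v.1, none)) (.goto fun _ => .inl false)))
        (.goto fun _ => .inl true))
  | .inl true =>
    .pop none (fun v o => (v.1, o))
      (.branch (fun v => v.2.isSome)
        (.push (some ⟨true, (M true).k₀⟩) (fun v => v.2.getD default)
          (.load (fun v => (v.1, none)) (.goto fun _ => .inl true)))
        (.goto fun _ => .inr ⟨true, (M true).main⟩))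
  | .inr l => lift l.1 ((M l.1).m l.2)

theorem stepsTo_running {i : Bool} {t : ℕ} {c c' : (M i).Cfg} (h : StepsTo (M i).step t c c') :
    StepsTo (TM2.step (stmt e)) t (running i c) (running i c') := by
  refine h.map ?_
  rintro ⟨_ | l, v, S⟩ b hb
  · cases hb
  · refine congrArg some ((stepAux_lift i _ _ _ (c := b) ?_).trans ?_)
    · simpa only [Function.update_self] using Option.some.inj hb
    · simp only [Function.update_idem]
      rfl

theorem stepsTo_empty (s : List ((M false).Γ (M false).k₁)) :
    StepsTo (TM2.step (stmt e)) (s.length + 1) (running false (haltList (M false) s))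
      (transferring true false (M false).k₁ [] (s.map e).reverse) := by
  have h := stepsTo_foldl (f := TM2.step (stmt e)) (c := transferring false false (M false).k₁)
    (d := transferring true false (M false).k₁ []) (g := fun w a => e a :: w)
    (fun a s w => by
      simp [transferring, stmt, TM2.step, TM2.stepAux, update_stk_none, update_stk_only])
    (fun w => by simp [transferring, stmt, TM2.step, TM2.stepAux, update_stk_only])
    s []
  rw [running_haltList]
  rwa [List.foldl_flip_cons_eq_append, List.append_nil] at h

theorem stepsTo_fill (w : List ((M true).Γ (M true).k₀)) :
    StepsTo (TM2.step (stmt e)) (w.length + 1) (transferring true true (M true).k₀ [] w)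
      (running true (initList (M true) w.reverse)) := by
  have h := stepsTo_foldl (f := TM2.step (stmt e))
    (c := fun w s => transferring true true (M true).k₀ s w)
    (d := fun s => running true (initList (M true) s)) (g := fun s a => a :: s)
    (fun a w s => by
      simp [transferring, stmt, TM2.step, TM2.stepAux, update_stk_none, update_stk_only])
    (fun s => by
      simp [transferring, stmt, TM2.step, TM2.stepAux, update_stk_none, initList_eq, running, embed,
        only])
    w []
  rwa [List.foldl_flip_cons_eq_append', List.append_nil] at h

/-- The pipeline as a machine. -/
def machine : FinTM2 where
  K := Stk M
  kFin := have := fun i => (M i).kFin; inferInstance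
  k₀ := some ⟨false, (M false).k₀⟩
  k₁ := some ⟨true, (M true).k₁⟩
  Γ := Alph M
  Λ := Lbl M
  main := .inr ⟨false, (M false).main⟩
  ΛFin := have := fun i => (M i).ΛFin; inferInstance
  σ := State M
  initialState := (fun i => (M i).initialState, none)
  σFin :=
    have := fun i => (M i).σFin
    have := (M true).Γk₀Fin
    inferInstance
  Γk₀Fin := (M false).Γk₀Fin
  m := stmt e

theorem initList_machine (s : List ((M false).Γ (M false).k₀)) :
    initList (machine e) s = running false (initList (M false) s) := by
  refine (initList_eq (machine e) s).trans ?_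
  rw [initList_eq, running, embed, Function.update_eq_self]
  exact congrArg (TM2.Cfg.mk _ _) (stk_only_nil false _ s).symm

theorem haltList_machine (s : List ((M true).Γ (M true).k₁)) :
    haltList (machine e) s = running true (haltList (M true) s) := by
  refine (haltList_eq (machine e) s).trans ?_
  rw [haltList_eq, running, embed, Function.update_eq_self]
  exact congrArg (TM2.Cfg.mk _ _) (stk_only_nil true _ s).symm

theorem stepsTo_machine {s : List ((M false).Γ (M false).k₀)} {s' : List ((M false).Γ (M false).k₁)}
    {s'' : List ((M true).Γ (M true).k₁)} {t t' : ℕ}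
    (h : StepsTo (M false).step t (initList (M false) s) (haltList (M false) s'))
    (h' : StepsTo (M true).step t' (initList (M true) (s'.map e)) (haltList (M true) s'')) :
    StepsTo (machine e).step (t + (s'.length + 1) + (s'.length + 1) + t')
      (initList (machine e) s) (haltList (machine e) s'') := by
  have hfill := stepsTo_fill e (s'.map e).reverse
  rw [List.length_reverse, List.length_map, List.reverse_reverse,
    transferring_nil true true false _ (M false).k₁] at hfill
  rw [initList_machine e, haltList_machine e]
  exact (((stepsTo_running e h).trans (stepsTo_empty e s')).trans hfill).trans
    (stepsTo_running e h')

end Pipeline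

section Computable

variable {α β γ αΓ βΓ γΓ : Type} {ea : α → List αΓ} {eb : β → List βΓ} {ec : γ → List γΓ}
  {f : α → β} {g : β → γ}

theorem exists_stepsTo (h : TM2ComputableInPolyTime ea eb f) (a : α) :
    ∃ t ≤ h.time.eval (ea a).length, StepsTo h.tm.step t
      (initList h.tm ((ea a).map h.inputAlphabet.symm))
      (haltList h.tm ((eb (f a)).map h.outputAlphabet.symm)) :=
  ⟨_, (h.outputsFun a).steps_le_m, stepsTo_iff.2 (h.outputsFun a).evals_in_steps⟩

theorem nonempty_computable (M : FinTM2) (iα : M.Γ M.k₀ ≃ αΓ) (oβ : M.Γ M.k₁ ≃ βΓ)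
    (p : Polynomial ℕ)
    (h : ∀ a, ∃ t ≤ p.eval (ea a).length, StepsTo M.step t
      (initList M ((ea a).map iα.symm)) (haltList M ((eb (f a)).map oβ.symm))) :
    Nonempty (TM2ComputableInPolyTime ea eb f) := by
  choose t ht hsteps using h
  exact ⟨⟨⟨M, iα, oβ⟩, p, fun a => ⟨⟨t a, stepsTo_iff.1 (hsteps a)⟩, ht a⟩⟩⟩

theorem nonempty_computable_comp [Inhabited βΓ] (hf : TM2ComputableInPolyTime ea eb f)
    (hg : TM2ComputableInPolyTime eb ec g) : Nonempty (TM2ComputableInPolyTime ea ec (g ∘ f)) := by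
  obtain ⟨C, hC⟩ := exists_length_le_of_stepsTo_haltList hf.tm
  let p : Polynomial ℕ := .X + .C C * hf.time
  let M : Bool → FinTM2 := Bool.rec hf.tm hg.tm
  let e : (M false).Γ (M false).k₁ → (M true).Γ (M true).k₀ :=
    fun a => hg.inputAlphabet.symm (hf.outputAlphabet a)
  have : Inhabited ((M true).Γ (M true).k₀) := ⟨hg.inputAlphabet.symm default⟩
  refine nonempty_computable (Pipeline.machine e) hf.inputAlphabet hg.outputAlphabet
    (hf.time + (p + 1) + (p + 1) + hg.time.comp p) fun a => ?_
  obtain ⟨t, ht, h⟩ := exists_stepsTo hf a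
  obtain ⟨t', ht', h'⟩ := exists_stepsTo hg (f a)
  have hlen : (eb (f a)).length ≤ p.eval (ea a).length := by
    have hlen := hC _ _ _ h
    simp only [List.length_map] at hlen
    simp only [p, Polynomial.eval_add, Polynomial.eval_mul, Polynomial.eval_X, Polynomial.eval_C]
    grw [hlen, ht]
  have hmap : ((eb (f a)).map hf.outputAlphabet.symm).map e =
      (eb (f a)).map hg.inputAlphabet.symm := by simp [e]
  refine ⟨_, ?_, Pipeline.stepsTo_machine e h (by rw [hmap]; exact h')⟩
  simp only [List.length_map, Polynomial.eval_add, Polynomial.eval_one, Polynomial.eval_comp]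
  grw [ht, ht', hlen, eval_le_eval _ hlen]

end Computable

/-! ### Programs with registers -/

/-- The registers of a program. -/
inductive Reg
  | inp | out | fml | len | cnt | gap | tmp | ovr | bad
  deriving DecidableEq

instance : Fintype Reg :=
  .ofList [.inp, .out, .fml, .len, .cnt, .gap, .tmp, .ovr, .bad] (by rintro ⟨⟩ <;> simp)

/-- The contents of the registers. Every register is a stack with its top at the head of the
list. -/
@[ext]
structure Store where
  (inp out fml len cnt gap tmp ovr bad : List Bool := [])

/-- The contents of a register. -/
def Store.get (S : Store) : Reg → List Bool
  | .inp => S.inp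
  | .out => S.out
  | .fml => S.fml
  | .len => S.len
  | .cnt => S.cnt
  | .gap => S.gap
  | .tmp => S.tmp
  | .ovr => S.ovr
  | .bad => S.bad

/-- Replaces the contents of a register. -/
def Store.set (S : Store) : Reg → List Bool → Store
  | .inp, s => { S with inp := s }
  | .out, s => { S with out := s }
  | .fml, s => { S with fml := s }
  | .len, s => { S with len := s }
  | .cnt, s => { S with cnt := s }
  | .gap, s => { S with gap := s }
  | .tmp, s => { S with tmp := s }
  | .ovr, s => { S with ovr := s }
  | .bad, s => { S with bad := s }

theorem Store.get_set (S : Store) (r : Reg) (s : List Bool) :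
    (S.set r s).get = Function.update S.get r s := by
  funext r'
  cases r <;> cases r' <;> rfl

theorem Store.set_set (S : Store) (r : Reg) (s t : List Bool) :
    (S.set r s).set r t = S.set r t := by
  cases r <;> rfl

theorem Store.set_get (S : Store) (r : Reg) : S.set r (S.get r) = S := by
  cases r <;> rfl

/-- The total length of the contents of all registers. -/
def Store.size (S : Store) : ℕ := ∑ r, (S.get r).length

theorem Store.size_set (S : Store) (r : Reg) (s : List Bool) :
    (S.set r s).size + (S.get r).length = S.size + s.length := by
  simp only [size, get_set, ← Finset.add_sum_erase Finset.univ _ (Finset.mem_univ r),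
    Function.update_self]
  rw [Finset.sum_congr rfl fun r' hr' => by rw [Function.update_of_ne (Finset.ne_of_mem_erase hr')]]
  omega

theorem Store.get_empty (r : Reg) : ({} : Store).get r = [] := by
  cases r <;> rfl

theorem Store.size_empty : ({} : Store).size = 0 := by
  simp [size, get_empty]

/-- Programs whose loops are bounded by the length of the input, so that all of them run in
polynomial time. A round of `loop r c P` pops a symbol `o` from the register `r` (`o = none` if
there is none) and runs `P o`; if `c o` holds, another round follows. -/
inductive Prog
  | nop
  | push (r : Reg) (b : Bool)
  | clear (r : Reg)
  | seq (P Q : Prog)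
  | loop (r : Reg) (c : Option Bool → Bool) (P : Option Bool → Prog)

/-- At most `m` rounds of a loop, where `g o` is the effect of the body after popping `o`. -/
def rounds (r : Reg) (c : Option Bool → Bool) (g : Option Bool → Store → Store) :
    ℕ → Store → Store
  | 0, S => S
  | m + 1, S =>
    let o := (S.get r).head?
    let S' := g o (S.set r (S.get r).tail)
    if c o then rounds r c g m S' else S'

namespace Prog

/-- The effect of a program whose loops are limited to `n + 1` rounds. -/
def eval (n : ℕ) : Prog → Store → Store
  | nop, S => S
  | push r b, S => S.set r (b :: S.get r)
  | clear r, S => S.set r []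
  | seq P Q, S => Q.eval n (P.eval n S)
  | loop r c P, S => rounds r c (fun o => (P o).eval n) (n + 1) S

/-- A bound for the amortised running time of a program, the potential being `Store.size`. -/
noncomputable def cost : Prog → Polynomial ℕ
  | nop => 1
  | push _ _ => 2
  | clear _ => 1
  | seq P Q => P.cost + Q.cost
  | loop _ _ P =>
    (.X + 1) * (6 + (P none).cost + (P (some false)).cost + (P (some true)).cost)

/-- The labels of a loop apart from those of its body. -/
inductive LoopLbl
  | enter | copy | restore | tick | flush
  deriving DecidableEq

instance : Fintype LoopLbl :=
  .ofList [.enter, .copy, .restore, .tick, .flush] (by rintro ⟨⟩ <;> simp)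

/-- The labels of the machine code of a program. -/
def Lbl : Prog → Type
  | nop => Unit
  | push _ _ => Unit
  | clear _ => Unit
  | seq P Q => P.Lbl ⊕ Q.Lbl
  | loop _ _ P => LoopLbl ⊕ Σ o, (P o).Lbl

noncomputable instance fintypeLbl : ∀ P : Prog, Fintype P.Lbl
  | nop => inferInstanceAs (Fintype Unit)
  | push _ _ => inferInstanceAs (Fintype Unit)
  | clear _ => inferInstanceAs (Fintype Unit)
  | seq P Q =>
    have := fintypeLbl P
    have := fintypeLbl Q
    inferInstanceAs (Fintype (P.Lbl ⊕ Q.Lbl))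
  | loop _ _ P =>
    have := fun o => fintypeLbl (P o)
    inferInstanceAs (Fintype (LoopLbl ⊕ Σ o, (P o).Lbl))

/-- The label at which the machine code of a program starts. -/
def entry : ∀ P : Prog, P.Lbl
  | nop => ()
  | push _ _ => ()
  | clear _ => ()
  | seq P _ => .inl P.entry
  | loop _ _ _ => .inl .enter

end Prog

/-- The stacks of the machine of a program: its registers, the length of the input in unary, an
auxiliary stack, and the clock, which limits the loops. -/
inductive Stk
  | reg (r : Reg)
  | size
  | aux
  | clk
  deriving DecidableEq, Fintype

/-- The statements of a machine over the stacks `Stk` that remembers the last popped symbol. -/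
abbrev Code (Λ : Type) : Type := TM2.Stmt (fun _ : Stk => Bool) Λ (Option Bool)

/-- Forgets the last popped symbol and goes to `l`. -/
def jump {Λ : Type} (l : Λ) : Code Λ := .load (fun _ => none) (.goto fun _ => l)

/-- Forgets the last popped symbol `o` and goes to `l o`. -/
def jumpTo {Λ : Type} (l : Option Bool → Λ) : Code Λ :=
  .branch Option.isNone (jump (l none))
    (.branch (· == some true) (jump (l (some true))) (jump (l (some false))))

/-- Pops a symbol; if there is one, runs `q` and repeats this label `l`, otherwise goes to `l'`. -/
def whileSome {Λ : Type} (k : Stk) (q : Code Λ → Code Λ) (l l' : Λ) : Code Λ :=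
  .pop k (fun _ o => o) (.branch Option.isSome (q (jump l)) (jump l'))

namespace Prog

/-- The machine code of a program. Entering a loop pushes a separator `false` and then `n + 1` ticks
`true` onto the clock, every round costs a tick, and leaving the loop removes the separator, so that
one clock serves nested loops as well. -/
def code {Λ : Type} : ∀ (P : Prog) (_emb : P.Lbl → Λ) (_exit : Λ), P.Lbl → Code Λ
  | nop, _, exit, _ => jump exit
  | push r b, _, exit, _ => .push (.reg r) (fun _ => b) (jump exit)
  | clear r, emb, exit, _ => whileSome (.reg r) id (emb ()) exit
  | seq P Q, emb, exit, l =>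
    l.elim (P.code (fun l => emb (.inl l)) (emb (.inr Q.entry)))
      (Q.code (fun l => emb (.inr l)) exit)
  | loop r c P, emb, exit, l => l.elim
    (fun
      | .enter => .push .clk (fun _ => false) (.push .clk (fun _ => true) (jump (emb (.inl .copy))))
      | .copy =>
        whileSome .size (fun q => .push .aux (fun _ => true) (.push .clk (fun _ => true) q))
          (emb (.inl .copy)) (emb (.inl .restore))
      | .restore =>
        whileSome .aux (.push .size fun _ => true) (emb (.inl .restore)) (emb (.inl .tick))
      | .tick => .pop .clk (fun _ o => o) (.branch (· == some true)
          (.pop (.reg r) (fun _ o => o) (jumpTo fun o => emb (.inr ⟨o, (P o).entry⟩)))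
          (jump exit))
      | .flush => .pop .clk (fun _ o => o)
          (.branch (· == some true) (jump (emb (.inl .flush))) (jump exit)))
    fun l => (P l.1).code (fun l' => emb (.inr ⟨l.1, l'⟩))
      (emb (.inl (if c l.1 then .tick else .flush))) l.2

/-- The contents of the stacks of the machine. -/
def stk (S : Store) (s a c : List Bool) : Stk → List Bool
  | .reg r => S.get r
  | .size => s
  | .aux => a
  | .clk => c

section update

variable (S : Store) (s a c x : List Bool)

theorem update_stk_reg (r : Reg) :
    Function.update (stk S s a c) (.reg r) x = stk (S.set r x) s a c := by
  funext k
  cases k <;> simp [stk, Store.get_set, Function.update_apply]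

theorem update_stk_size : Function.update (stk S s a c) .size x = stk S x a c := by
  funext k
  cases k <;> rfl

theorem update_stk_aux : Function.update (stk S s a c) .aux x = stk S s x c := by
  funext k
  cases k <;> rfl

theorem update_stk_clk : Function.update (stk S s a c) .clk x = stk S s a x := by
  funext k
  cases k <;> rfl

end update

section Simulation

variable {Λ : Type} {M : Λ → Code Λ}

/-- The configuration of the machine at the label `l`. -/
def cfg (l : Λ) (S : Store) (s a c : List Bool) : TM2.Cfg (fun _ : Stk => Bool) Λ (Option Bool) :=
  ⟨some l, none, stk S s a c⟩

theorem stepAux_jumpTo (l : Option Bool → Λ) (o : Option Bool) (T : Stk → List Bool) :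
    TM2.stepAux (jumpTo l) o T = ⟨some (l o), none, T⟩ := by
  rcases o with _ | _ | _ <;> rfl

/-- `P` is compiled into the machine `M`, from the label `emb P.entry` to the label `exit`. -/
def IsCompiled (M : Λ → Code Λ) (P : Prog) (emb : P.Lbl → Λ) (exit : Λ) : Prop :=
  ∀ l, M (emb l) = P.code emb exit l

/-- With loops limited to `n + 1` rounds, the machine `M` gets from `l` to `l'` while turning the
store `S` into `S'`, in amortised time `B`. -/
def Simulates (M : Λ → Code Λ) (n B : ℕ) (l l' : Λ) (S S' : Store) : Prop :=
  ∀ c, ∃ t, t + S'.size ≤ S.size + B ∧ StepsTo (TM2.step M) t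
    (cfg l S (.replicate n true) [] c) (cfg l' S' (.replicate n true) [] c)

theorem stepsTo_clear {l l' : Λ} {r : Reg} (hl : M l = whileSome (.reg r) id l l') (S : Store)
    (s a c : List Bool) :
    StepsTo (TM2.step M) ((S.get r).length + 1) (cfg l S s a c) (cfg l' (S.set r []) s a c) := by
  have h := stepsTo_foldl (f := TM2.step M) (c := fun x (_ : Unit) => cfg l (S.set r x) s a c)
    (d := fun _ => cfg l' (S.set r []) s a c) (g := fun _ _ => ())
    (fun b x _ => by
      simp [cfg, TM2.step, hl, whileSome, jump, TM2.stepAux, update_stk_reg, stk, Store.get_set,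
        Store.set_set])
    (fun _ => by
      simp [cfg, TM2.step, hl, whileSome, jump, TM2.stepAux, update_stk_reg, stk, Store.get_set,
        Store.set_set])
    (S.get r) ()
  rwa [Store.set_get] at h

section Loop

variable {r : Reg} {c : Option Bool → Bool} {P : Option Bool → Prog} {emb : (loop r c P).Lbl → Λ}
  {exit : Λ}

theorem stepsTo_copy (hM : IsCompiled M (loop r c P) emb exit) (S : Store) (k : List Bool) (n : ℕ) :
    StepsTo (TM2.step M) (n + 1) (cfg (emb (.inl .copy)) S (.replicate n true) [] k)
      (cfg (emb (.inl .restore)) S [] (.replicate n true) (.replicate n true ++ k)) := by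
  have h (n a : ℕ) (k : List Bool) : StepsTo (TM2.step M) (n + 1)
      (cfg (emb (.inl .copy)) S (.replicate n true) (.replicate a true) k)
      (cfg (emb (.inl .restore)) S [] (.replicate (a + n) true) (.replicate n true ++ k)) := by
    induction n generalizing a k with
    | zero =>
      refine .single ?_
      simp [cfg, TM2.step, hM (.inl .copy), code, whileSome, jump, TM2.stepAux, stk,
        update_stk_size]
    | succ n ih =>
      have hn : List.replicate (n + 1) true ++ k = List.replicate n true ++ true :: k := by
        rw [List.replicate_succ', List.append_assoc, List.singleton_append]
      rw [hn, ← Nat.add_assoc a, Nat.add_right_comm a]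
      refine .head ?_ (ih (a + 1) (true :: k))
      simp [cfg, TM2.step, hM (.inl .copy), code, whileSome, jump, TM2.stepAux, stk,
        update_stk_size, update_stk_aux, update_stk_clk, List.replicate_succ]
  simpa using h n 0 k

theorem stepsTo_restore (hM : IsCompiled M (loop r c P) emb exit) (S : Store) (k : List Bool)
    (n : ℕ) : StepsTo (TM2.step M) (n + 1)
      (cfg (emb (.inl .restore)) S [] (.replicate n true) k)
      (cfg (emb (.inl .tick)) S (.replicate n true) [] k) := by
  have h := stepsTo_foldl (f := TM2.step M)
    (c := fun x m => cfg (emb (.inl .restore)) S (.replicate m true) x k)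
    (d := fun m => cfg (emb (.inl .tick)) S (.replicate m true) [] k) (g := fun m _ => m + 1)
    (fun b x _ => by
      simp [cfg, TM2.step, hM (.inl .restore), code, whileSome, jump, TM2.stepAux, stk,
        update_stk_size, update_stk_aux, List.replicate_succ])
    (fun _ => by
      simp [cfg, TM2.step, hM (.inl .restore), code, whileSome, jump, TM2.stepAux, stk,
        update_stk_aux]) (.replicate n true) 0
  simpa [List.foldl_const] using h

theorem stepsTo_flush (hM : IsCompiled M (loop r c P) emb exit) (S : Store) (s a k : List Bool)
    (n : ℕ) : StepsTo (TM2.step M) (n + 1)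
      (cfg (emb (.inl .flush)) S s a (.replicate n true ++ false :: k))
      (cfg exit S s a k) := by
  induction n with
  | zero =>
    refine .single ?_
    simp [cfg, TM2.step, hM (.inl .flush), code, jump, TM2.stepAux, stk, update_stk_clk]
  | succ n ih =>
    refine .head ?_ ih
    simp [cfg, TM2.step, hM (.inl .flush), code, jump, TM2.stepAux, stk, update_stk_clk,
      List.replicate_succ]

theorem step_tick (hM : IsCompiled M (loop r c P) emb exit) (S : Store) (s a k : List Bool) :
    TM2.step M (cfg (emb (.inl .tick)) S s a (true :: k)) =
      some (cfg (emb (.inr ⟨_, (P (S.get r).head?).entry⟩)) (S.set r (S.get r).tail) s a k) := by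
  simp [cfg, TM2.step, hM (.inl .tick), code, stepAux_jumpTo, TM2.stepAux, stk, update_stk_clk,
    update_stk_reg]

theorem step_tick_exit (hM : IsCompiled M (loop r c P) emb exit) (S : Store) (s a k : List Bool) :
    TM2.step M (cfg (emb (.inl .tick)) S s a (false :: k)) = some (cfg exit S s a k) := by
  simp [cfg, TM2.step, hM (.inl .tick), code, jump, TM2.stepAux, stk, update_stk_clk]

theorem step_enter (hM : IsCompiled M (loop r c P) emb exit) (S : Store) (s a k : List Bool) :
    TM2.step M (cfg (emb (.inl .enter)) S s a k) =
      some (cfg (emb (.inl .copy)) S s a (true :: false :: k)) := by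
  simp [cfg, TM2.step, hM (.inl .enter), code, jump, TM2.stepAux, stk, update_stk_clk]

theorem stepsTo_rounds (hM : IsCompiled M (loop r c P) emb exit) {n B : ℕ}
    (h : ∀ o S, Simulates M n B (emb (.inr ⟨o, (P o).entry⟩))
      (emb (.inl (if c o then .tick else .flush))) S ((P o).eval n S))
    (m : ℕ) (S : Store) (k : List Bool) :
    ∃ t, t + (rounds r c (fun o => (P o).eval n) m S).size ≤ S.size + (m * (B + 2) + 1) ∧
      StepsTo (TM2.step M) t
        (cfg (emb (.inl .tick)) S (.replicate n true) [] (.replicate m true ++ false :: k))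
        (cfg exit (rounds r c (fun o => (P o).eval n) m S) (.replicate n true) [] k) := by
  induction m generalizing S with
  | zero => exact ⟨1, by simp [rounds, add_comm], .single (step_tick_exit hM _ _ _ _)⟩
  | succ m ih =>
    obtain ⟨t, ht, hbody⟩ := h (S.get r).head? (S.set r (S.get r).tail)
      (.replicate m true ++ false :: k)
    have hsize : (S.set r (S.get r).tail).size ≤ S.size := by
      have h := S.size_set r (S.get r).tail
      rw [List.length_tail] at h
      omega
    rw [rounds]
    split_ifs with hc
    · obtain ⟨t', ht', hrest⟩ := ih ((P (S.get r).head?).eval n (S.set r (S.get r).tail))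
      rw [if_pos hc] at hbody
      exact ⟨_, by linarith, .head (step_tick hM _ _ _ _) (hbody.trans hrest)⟩
    · rw [if_neg hc] at hbody
      have hflush := stepsTo_flush hM ((P (S.get r).head?).eval n (S.set r (S.get r).tail))
        (.replicate n true) [] k m
      exact ⟨_, by nlinarith, .head (step_tick hM _ _ _ _) (hbody.trans hflush)⟩

theorem simulates_loop (hM : IsCompiled M (loop r c P) emb exit) {n B : ℕ}
    (h : ∀ o S, Simulates M n B (emb (.inr ⟨o, (P o).entry⟩))
      (emb (.inl (if c o then .tick else .flush))) S ((P o).eval n S)) (S : Store) :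
    Simulates M n ((n + 1) * (6 + B)) (emb (.inl .enter)) exit S ((loop r c P).eval n S) := by
  intro k
  obtain ⟨t, ht, hrounds⟩ := stepsTo_rounds hM h (n + 1) S k
  rw [List.replicate_succ', List.append_assoc] at hrounds
  refine ⟨_, ?_, .head (step_enter hM S _ [] k) (((stepsTo_copy hM S _ n).trans
    (stepsTo_restore hM S _ n)).trans hrounds)⟩
  rw [eval]
  linarith

end Loop

theorem Simulates.trans {n B B' : ℕ} {l l' l'' : Λ} {S S' S'' : Store}
    (h : Simulates M n B l l' S S') (h' : Simulates M n B' l' l'' S' S'') :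
    Simulates M n (B + B') l l'' S S'' := fun c =>
  let ⟨t, ht, hs⟩ := h c
  let ⟨t', ht', hs'⟩ := h' c
  ⟨t + t', by omega, hs.trans hs'⟩

theorem Simulates.mono {n B B' : ℕ} {l l' : Λ} {S S' : Store} (h : Simulates M n B l l' S S')
    (hB : B ≤ B') : Simulates M n B' l l' S S' := fun c =>
  let ⟨t, ht, hs⟩ := h c
  ⟨t, by omega, hs⟩

theorem simulates_eval (n : ℕ) (P : Prog) {emb : P.Lbl → Λ} {exit : Λ}
    (hM : IsCompiled M P emb exit) (S : Store) :
    Simulates M n (P.cost.eval n) (emb P.entry) exit S (P.eval n S) := by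
  induction P generalizing exit S with
  | nop =>
    refine fun c => ⟨1, by simp [cost, eval, add_comm], .single ?_⟩
    simp [cfg, TM2.step, hM _, code, jump, TM2.stepAux, eval]
  | push r b =>
    refine fun c => ⟨1, ?_, .single ?_⟩
    · have hsize := S.size_set r (b :: S.get r)
      simp only [cost, eval, Polynomial.eval_ofNat, List.length_cons] at hsize ⊢
      omega
    · simp [cfg, TM2.step, hM _, code, jump, TM2.stepAux, eval, stk, update_stk_reg]
  | clear r =>
    refine fun c => ⟨_, ?_, stepsTo_clear (hM ()) _ _ _ _⟩
    have hsize := S.size_set r []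
    simp only [cost, eval, Polynomial.eval_one, List.length_nil] at hsize ⊢
    omega
  | seq P Q ihP ihQ =>
    have hP := ihP (emb := fun l => emb (.inl l)) (exit := emb (.inr Q.entry))
      (fun l => hM (.inl l)) S
    have hQ := ihQ (emb := fun l => emb (.inr l)) (fun l => hM (.inr l)) (P.eval n S)
    rw [cost, Polynomial.eval_add]
    exact hP.trans hQ
  | loop r c P ih =>
    simp only [cost, Polynomial.eval_mul, Polynomial.eval_add, Polynomial.eval_X,
      Polynomial.eval_one, Polynomial.eval_ofNat, add_assoc (6 : ℕ)]
    refine simulates_loop hM (fun o S => ?_) S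
    refine (ih o (emb := fun l => emb (.inr ⟨o, l⟩))
      (exit := emb (.inl (if c o then .tick else .flush))) (fun l => hM (.inr ⟨o, l⟩)) S).mono ?_
    rcases o with _ | _ | _ <;> omega

end Simulation

end Prog

/-- Empties all registers but `out`. -/
def Prog.cleanup : Prog :=
  [Reg.fml, .len, .cnt, .gap, .tmp, .ovr, .bad].foldl (fun P r => .seq P (.clear r)) (.clear .inp)

theorem Prog.eval_cleanup (n : ℕ) (S : Store) : cleanup.eval n S = { out := S.out } := rfl

namespace Machine

/-- The labels of the machine of a program, apart from those of its code. -/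
inductive Ctrl
  | fill | unfill | pour | drain | halt
  deriving DecidableEq

instance : Fintype Ctrl :=
  .ofList [.fill, .unfill, .pour, .drain, .halt] (by rintro ⟨⟩ <;> simp)

variable (P : Prog)

/-- The machine of a program measures its input, runs the program, moves the output to the stack
`Stk.aux`, which reverses it, and empties all other stacks. -/
def code : Ctrl ⊕ (P.seq .cleanup).Lbl → Code (Ctrl ⊕ (P.seq .cleanup).Lbl) := Sum.elim
  (fun
    | .fill => whileSome (.reg .inp)
        (fun q => .push .size (fun _ => true) (.push .aux (fun o => o.getD false) q))
        (.inl .fill) (.inl .unfill)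
    | .unfill => whileSome .aux (.push (.reg .inp) fun o => o.getD false) (.inl .unfill)
        (.inr (P.seq .cleanup).entry)
    | .pour => whileSome (.reg .out) (.push .aux fun o => o.getD false) (.inl .pour) (.inl .drain)
    | .drain => whileSome .size id (.inl .drain) (.inl .halt)
    | .halt => .halt)
  ((P.seq .cleanup).code .inr (.inl .pour))

open Prog

theorem stepsTo_fill (s : List Bool) :
    StepsTo (TM2.step (code P)) (s.length + 1) (cfg (.inl .fill) { inp := s } [] [] [])
      (cfg (.inl .unfill) {} (.replicate s.length true) s.reverse []) := by
  have h := stepsTo_foldl (f := TM2.step (code P))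
    (c := fun x y => cfg (.inl .fill) { inp := x } (.replicate y.length true) y [])
    (d := fun y => cfg (.inl .unfill) {} (.replicate y.length true) y [])
    (g := fun y b => b :: y)
    (fun b x y => by
      simp [cfg, TM2.step, code, whileSome, jump, TM2.stepAux, stk, update_stk_reg,
        update_stk_size, update_stk_aux, Store.get, Store.set, List.replicate_succ])
    (fun y => by
      simp [cfg, TM2.step, code, whileSome, jump, TM2.stepAux, stk, update_stk_reg,
        Store.get, Store.set]) s []
  simpa [List.foldl_flip_cons_eq_append'] using h

theorem stepsTo_unfill (s z : List Bool) :
    StepsTo (TM2.step (code P)) (s.length + 1) (cfg (.inl .unfill) {} z s [])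
      (cfg (.inr (P.seq .cleanup).entry) { inp := s.reverse } z [] []) := by
  have h := stepsTo_foldl (f := TM2.step (code P))
    (c := fun x y => cfg (.inl .unfill) { inp := y } z x [])
    (d := fun y => cfg (.inr (P.seq .cleanup).entry) { inp := y } z [] [])
    (g := fun y b => b :: y)
    (fun b x y => by
      simp [cfg, TM2.step, code, whileSome, jump, TM2.stepAux, stk, update_stk_reg,
        update_stk_aux, Store.get, Store.set])
    (fun y => by
      simp [cfg, TM2.step, code, whileSome, jump, TM2.stepAux, stk, update_stk_aux]) s []
  simpa [List.foldl_flip_cons_eq_append'] using h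

theorem stepsTo_pour (s z : List Bool) :
    StepsTo (TM2.step (code P)) (s.length + 1) (cfg (.inl .pour) { out := s } z [] [])
      (cfg (.inl .drain) {} z s.reverse []) := by
  have h := stepsTo_foldl (f := TM2.step (code P))
    (c := fun x y => cfg (.inl .pour) { out := x } z y [])
    (d := fun y => cfg (.inl .drain) {} z y [])
    (g := fun y b => b :: y)
    (fun b x y => by
      simp [cfg, TM2.step, code, whileSome, jump, TM2.stepAux, stk, update_stk_reg,
        update_stk_aux, Store.get, Store.set])
    (fun y => by
      simp [cfg, TM2.step, code, whileSome, jump, TM2.stepAux, stk, update_stk_reg, Store.get,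
        Store.set]) s []
  simpa [List.foldl_flip_cons_eq_append'] using h

theorem stepsTo_drain (s z : List Bool) :
    StepsTo (TM2.step (code P)) (z.length + 1) (cfg (.inl .drain) {} z s [])
      (cfg (.inl .halt) {} [] s []) :=
  stepsTo_foldl (f := TM2.step (code P)) (c := fun x (_ : Unit) => cfg (.inl .drain) {} x s [])
    (d := fun _ => cfg (.inl .halt) {} [] s []) (g := fun _ _ => ())
    (fun b x _ => by
      simp [cfg, TM2.step, code, whileSome, jump, TM2.stepAux, stk, update_stk_size])
    (fun _ => by
      simp [cfg, TM2.step, code, whileSome, jump, TM2.stepAux, stk, update_stk_size]) z ()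

/-- The machine of a program. -/
noncomputable def machine : FinTM2 where
  K := Stk
  k₀ := .reg .inp
  k₁ := .aux
  Γ _ := Bool
  Λ := Ctrl ⊕ (P.seq .cleanup).Lbl
  main := .inl .fill
  σ := Option Bool
  initialState := none
  m := code P

theorem stk_nil : stk {} [] [] [] = fun _ => [] := by
  funext k
  rcases k with (_ | _) | _ | _ | _ <;> rfl

theorem initList_machine (s : List Bool) :
    initList (machine P) s = cfg (.inl .fill) { inp := s } [] [] [] := by
  refine (initList_eq (machine P) s).trans (congrArg (TM2.Cfg.mk _ _) ?_)
  change Function.update (fun _ : Stk => []) (.reg .inp) s = _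
  rw [← stk_nil, update_stk_reg]
  rfl

theorem haltList_machine (s : List Bool) :
    haltList (machine P) s = ⟨none, none, stk {} [] s []⟩ := by
  refine (haltList_eq (machine P) s).trans (congrArg (TM2.Cfg.mk _ _) ?_)
  change Function.update (fun _ : Stk => []) .aux s = _
  rw [← stk_nil, update_stk_aux]

theorem exists_stepsTo_machine (s : List Bool) :
    ∃ t ≤ ((P.seq .cleanup).cost + 4 * .X + 5).eval s.length,
      StepsTo (machine P).step t (initList (machine P) s)
        (haltList (machine P) (P.eval s.length { inp := s }).out.reverse) := by
  obtain ⟨t, ht, hrun⟩ := simulates_eval (M := code P) s.length (P.seq .cleanup) (emb := .inr)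
    (exit := .inl .pour) (fun _ => rfl) { inp := s } []
  rw [Prog.eval, eval_cleanup] at ht hrun
  set out := (P.eval s.length { inp := s }).out
  have hsize (r : Reg) (x : List Bool) : (Store.set {} r x).size = x.length := by
    have h := Store.size_set {} r x
    rwa [Store.size_empty, Store.get_empty, List.length_nil, zero_add, add_zero] at h
  have hin := stepsTo_unfill P s.reverse (.replicate s.length true)
  have hout := (stepsTo_pour P out (.replicate s.length true)).trans (stepsTo_drain P _ _)
  rw [List.length_reverse, List.reverse_reverse] at hin
  rw [initList_machine, haltList_machine]
  refine ⟨_, ?_, (((stepsTo_fill P s).trans hin).trans (hrun.trans hout)).trans (.single rfl)⟩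
  have hs := hsize .inp s
  have ho := hsize .out out
  simp only [Store.set] at hs ho
  simp only [List.length_replicate, Polynomial.eval_add, Polynomial.eval_mul, Polynomial.eval_X,
    Polynomial.eval_ofNat]
  omega

end Machine

theorem nonempty_computable_of_eval {α β : Type} {ea : α → List Bool} {eb : β → List Bool}
    {f : α → β} (P : Prog)
    (h : ∀ a, (P.eval (ea a).length { inp := ea a }).out.reverse = eb (f a)) :
    Nonempty (TM2ComputableInPolyTime ea eb f) :=
  nonempty_computable (Machine.machine P) (.refl Bool) (.refl Bool)
    ((P.seq .cleanup).cost + 4 * .X + 5) fun a => by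
    obtain ⟨t, ht, hsteps⟩ := Machine.exists_stepsTo_machine P (ea a)
    rw [h a] at hsteps
    exact ⟨t, ht, (congrArg₂ (StepsTo _ t) (congrArg _ (List.map_id _))
      (congrArg _ (List.map_id _))).mpr hsteps⟩

end Machines

/-! ### Rewriting expressions -/

theorem Store.set_comm (S : Store) {r r' : Reg} (h : r ≠ r') (s t : List Bool) :
    (S.set r s).set r' t = (S.set r' t).set r s := by
  cases r <;> cases r' <;> first | rfl | exact absurd rfl h

theorem rounds_isSome {r : Reg} {g : Option Bool → Store → Store} {γ : Store → Bool → Store}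
    (hsome : ∀ b s S, g (some b) (S.set r s) = (γ S b).set r s) (hnone : ∀ S, g none S = S) {m : ℕ}
    {s : List Bool} (hm : s.length ≤ m) (S : Store) :
    rounds r Option.isSome g (m + 1) (S.set r s) = (s.foldl γ S).set r [] := by
  induction s generalizing m S with
  | nil => simp [rounds, Store.get_set, Store.set_set, hnone]
  | cons b s ih =>
    obtain ⟨m, rfl⟩ := Nat.exists_eq_add_of_lt hm
    rw [rounds]
    simp only [Store.get_set, Store.set_set, Function.update_self, List.head?_cons, List.tail_cons,
      hsome, Option.isSome_some, if_true, List.foldl_cons]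
    exact ih (by omega) _

theorem rounds_ones {r : Reg} {c : Option Bool → Bool} {g : Option Bool → Store → Store}
    {F : ℕ → List Bool → Store} (hget : ∀ i s, (F i s).get r = s)
    (hset : ∀ i s s', (F i s).set r s' = F i s') {k : ℕ} {s : List Bool}
    (htrue : c (some true)) (hs : c s.head? = false)
    (hg : ∀ i j, i + j + 1 = k →
      g (some true) (F i (.replicate j true ++ s)) = F (i + 1) (.replicate j true ++ s))
    {m : ℕ} (hm : k ≤ m) :
    rounds r c g (m + 1) (F 0 (.replicate k true ++ s)) = g s.head? (F k s.tail) := by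
  have h (j : ℕ) : ∀ i m, i + j = k → j ≤ m →
      rounds r c g (m + 1) (F i (.replicate j true ++ s)) = g s.head? (F k s.tail) := by
    induction j with
    | zero =>
      rintro i m rfl -
      simp [rounds, hget, hset, hs]
    | succ j ih =>
      intro i m hi hj
      obtain ⟨m, rfl⟩ := Nat.exists_eq_add_of_lt hj
      rw [rounds]
      simp only [hget, hset, List.replicate_succ, List.cons_append, List.head?_cons,
        List.tail_cons, htrue, hg i j (by omega), if_true]
      exact ih _ _ (by omega) (by omega)
  exact h k 0 m (by omega) hm

/-- The substitution of expressions for the variables. -/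
def BExpr.bind {V W : Type} (σ : V → BExpr W) : BExpr V → BExpr W
  | .var v => σ v
  | .not e => .not (e.bind σ)
  | .and e₁ e₂ => .and (e₁.bind σ) (e₂.bind σ)
  | .or e₁ e₂ => .or (e₁.bind σ) (e₂.bind σ)

theorem BExpr.eval_bind {V W : Type} (σ : V → BExpr W) (e : BExpr V) (a : W → Bool) :
    (e.bind σ).eval a = e.eval fun v => (σ v).eval a := by
  induction e <;> simp_all [bind, eval]

namespace Prog

/-- Appends `w` to the output. -/
def emit (w : List Bool) : Prog := w.foldr (fun b P => (push .out b).seq P) nop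

/-- Pops a symbol `o`, `none` if there is none, and runs `P o`. -/
def pop (r : Reg) (P : Option Bool → Prog) : Prog := loop r (fun _ => false) P

/-- Moves a number in unary from the input to the output. -/
def copyUnary : Prog := loop .inp (· == some true) fun o => push .out (o.getD false)

/-- Moves the contents of `r` onto `r'`, reversing their order. -/
def pour (r r' : Reg) : Prog :=
  loop r Option.isSome fun o => o.elim nop (push r')

/-- Moves the contents of `r` onto both `r'` and `r''`, reversing their order. -/
def pour₂ (r r' r'' : Reg) : Prog :=
  loop r Option.isSome fun o => o.elim nop fun b => (push r' b).seq (push r'' b)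

/-- Copies the contents of `r` onto `r'`, reversing their order. -/
def copy (r r' : Reg) : Prog := (pour₂ r .tmp r').seq (pour .tmp r)

/-- Copies the formula to the input. -/
def reload : Prog := (pour .fml .tmp).seq (pour₂ .tmp .fml .inp)

/-- Reads the rest of a token beginning with `o` and writes the token again, with `V` treating the
number of a variable. -/
def token (V : Prog) : Option Bool → Prog
  | none => nop
  | some true => pop .inp fun o => emit [true, o.getD false]
  | some false => pop .inp fun o => if o = some true then emit [false, true] else V

/-- Reads an expression and writes it again, with `V` treating the numbers of the variables. -/
def tokens (V : Prog) : Prog := loop .inp Option.isSome (token V)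

theorem eval_emit (w : List Bool) (n : ℕ) (S : Store) :
    (emit w).eval n S = S.set .out (w.reverse ++ S.out) := by
  induction w generalizing S with
  | nil => rfl
  | cons b w ih => simp [emit, eval] at ih ⊢; simp [ih, Store.set, Store.get]

theorem eval_pop (r : Reg) (P : Option Bool → Prog) (n : ℕ) (S : Store) :
    (pop r P).eval n S = (P (S.get r).head?).eval n (S.set r (S.get r).tail) := by
  simp [pop, eval, rounds]

theorem eval_pour {r r' : Reg} (h : r ≠ r') {n : ℕ} {S : Store} (hn : (S.get r).length ≤ n) :
    (pour r r').eval n S = (S.set r []).set r' ((S.get r).reverse ++ S.get r') := by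
  have hfold (s : List Bool) (S : Store) :
      s.foldl (fun S b => S.set r' (b :: S.get r')) S = S.set r' (s.reverse ++ S.get r') := by
    induction s generalizing S with
    | nil => simp [Store.set_get]
    | cons b s ih => simp [ih, Store.get_set, Store.set_set]
  have hloop := rounds_isSome (r := r) (g := fun o => (o.elim nop (push r')).eval n)
    (γ := fun S b => S.set r' (b :: S.get r'))
    (fun b s S => by simp [eval, Store.get_set, h.symm, S.set_comm h]) (fun S => rfl) hn S
  rwa [Store.set_get, hfold, ← Store.set_comm _ h] at hloop

theorem eval_pour₂ {r r' r'' : Reg} (h : r ≠ r') (h' : r ≠ r'') (h'' : r' ≠ r'') {n : ℕ} {S : Store}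
    (hn : (S.get r).length ≤ n) :
    (pour₂ r r' r'').eval n S = ((S.set r []).set r' ((S.get r).reverse ++ S.get r')).set r''
      ((S.get r).reverse ++ S.get r'') := by
  have hfold (s : List Bool) (S : Store) :
      s.foldl (fun S b => (S.set r' (b :: S.get r')).set r'' (b :: S.get r'')) S =
        (S.set r' (s.reverse ++ S.get r')).set r'' (s.reverse ++ S.get r'') := by
    induction s generalizing S with
    | nil => simp [Store.set_get]
    | cons b s ih =>
      simp [ih, Store.get_set, Store.set_set, h'', Store.set_comm _ h''.symm]
  have hloop := rounds_isSome (r := r)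
    (g := fun o => (o.elim nop fun b => (push r' b).seq (push r'' b)).eval n)
    (γ := fun S b => (S.set r' (b :: S.get r')).set r'' (b :: S.get r''))
    (fun b s S => by
      simp [eval, Store.get_set, h.symm, h'.symm, h''.symm, S.set_comm h, Store.set_comm _ h'])
    (fun S => rfl) hn S
  rwa [Store.set_get, hfold, ← Store.set_comm _ h', ← Store.set_comm _ h] at hloop

theorem eval_copy {r r' : Reg} (h : r ≠ .tmp) (h' : r' ≠ .tmp) (h'' : r ≠ r') {n : ℕ} {S : Store}
    (htmp : S.tmp = []) (hn : (S.get r).length ≤ n) :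
    (copy r r').eval n S = S.set r' ((S.get r).reverse ++ S.get r') := by
  have hget : S.get .tmp = [] := htmp
  rw [copy, eval, eval_pour₂ h h'' h'.symm hn, eval_pour h.symm] <;>
    simp only [Store.get_set, Function.update_self, Function.update_of_ne, ne_eq, h, h'', h'.symm,
      not_false_eq_true, hget, List.append_nil, List.reverse_reverse,
      List.length_reverse, hn]
  rw [Store.set_comm _ h'.symm, Store.set_set, Store.set_comm _ h.symm, Store.set_comm _ h''.symm,
    Store.set_set, Store.set_get, Store.set_comm _ h', ← hget, Store.set_get]

section Registers

variable {n : ℕ} {inp out fml len cnt gap tmp ovr bad : List Bool}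

theorem eval_copyUnary {k : ℕ} (hk : k ≤ n) :
    copyUnary.eval n ⟨unary k ++ inp, out, fml, len, cnt, gap, tmp, ovr, bad⟩ =
      ⟨inp, (unary k).reverse ++ out, fml, len, cnt, gap, tmp, ovr, bad⟩ := by
  have h := rounds_ones (r := .inp) (c := (· == some true)) (s := false :: inp)
    (g := fun o => (push .out (o.getD false)).eval n)
    (F := fun i s => ⟨s, .replicate i true ++ out, fml, len, cnt, gap, tmp, ovr, bad⟩)
    (fun _ _ => rfl) (fun _ _ _ => rfl) rfl rfl (fun _ _ _ => rfl) hk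
  simpa [copyUnary, unary, eval, Store.set, Store.get] using h

theorem eval_reload (hn : fml.length ≤ n) :
    reload.eval n ⟨inp, out, fml, len, cnt, gap, [], ovr, bad⟩ =
      ⟨fml ++ inp, out, fml, len, cnt, gap, [], ovr, bad⟩ := by
  rw [reload, eval, eval_pour (by decide) hn, eval_pour₂ (by decide) (by decide) (by decide)] <;>
    simp [Store.get, Store.set, hn]

/-- `V` replaces the number of every variable by the expression that `σ` substitutes for it. -/
def Substitutes {X Y : Type} (V : Prog) (n : ℕ) (num : X → ℕ) (σ : X → BExpr Y) (num' : Y → ℕ)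
    (fml len cnt gap tmp ovr bad : List Bool) : Prop :=
  ∀ v inp out, V.eval n ⟨unary (num v) ++ inp, out, fml, len, cnt, gap, tmp, ovr, bad⟩ =
    ⟨inp, ((σ v).bits num').reverse ++ out, fml, len, cnt, gap, tmp, ovr, bad⟩

theorem eval_token_true (V : Prog) (b : Bool) :
    (token V (some true)).eval n ⟨b :: inp, out, fml, len, cnt, gap, tmp, ovr, bad⟩ =
      ⟨inp, b :: true :: out, fml, len, cnt, gap, tmp, ovr, bad⟩ := rfl

theorem eval_token_not (V : Prog) :
    (token V (some false)).eval n ⟨true :: inp, out, fml, len, cnt, gap, tmp, ovr, bad⟩ =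
      ⟨inp, true :: false :: out, fml, len, cnt, gap, tmp, ovr, bad⟩ := rfl

theorem eval_token_var (V : Prog) :
    (token V (some false)).eval n ⟨false :: inp, out, fml, len, cnt, gap, tmp, ovr, bad⟩ =
      V.eval n ⟨inp, out, fml, len, cnt, gap, tmp, ovr, bad⟩ := rfl

theorem exists_rounds_tokens {X Y : Type} {V : Prog} {num : X → ℕ} {σ : X → BExpr Y} {num' : Y → ℕ}
    (hV : V.Substitutes n num σ num' fml len cnt gap tmp ovr bad) (e : BExpr X) :
    ∃ k ≤ (e.bits num).length, ∀ m inp out,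
      rounds .inp Option.isSome (fun o => (token V o).eval n) (k + m)
        ⟨e.bits num ++ inp, out, fml, len, cnt, gap, tmp, ovr, bad⟩ =
      rounds .inp Option.isSome (fun o => (token V o).eval n) m
        ⟨inp, ((e.bind σ).bits num').reverse ++ out, fml, len, cnt, gap, tmp, ovr, bad⟩ := by
  induction e with
  | var v =>
    refine ⟨1, by simp [BExpr.bits], fun m inp out => ?_⟩
    have h := hV v inp out
    simp [add_comm, rounds, Store.get, Store.set, BExpr.bits, BExpr.bind, eval_token_var, h]
  | not e ih =>
    obtain ⟨k, hk, h⟩ := ih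
    refine ⟨k + 1, by simpa [BExpr.bits] using hk.step, fun m inp out => ?_⟩
    simp [add_right_comm k 1, rounds, Store.get, Store.set, BExpr.bits, BExpr.bind, eval_token_not,
      h]
  | and e₁ e₂ ih₁ ih₂ | or e₁ e₂ ih₁ ih₂ =>
    obtain ⟨k₁, hk₁, h₁⟩ := ih₁
    obtain ⟨k₂, hk₂, h₂⟩ := ih₂
    refine ⟨k₁ + k₂ + 1, ?_, fun m inp out => ?_⟩
    · simp only [BExpr.bits, List.length_cons, List.length_append]
      omega
    · simp [add_right_comm _ 1, add_assoc k₁, rounds, Store.get, Store.set, BExpr.bits,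
        BExpr.bind, eval_token_true, h₁, h₂]

theorem eval_tokens {X Y : Type} {V : Prog} {num : X → ℕ} {σ : X → BExpr Y} {num' : Y → ℕ}
    (hV : V.Substitutes n num σ num' fml len cnt gap tmp ovr bad) {e : BExpr X}
    (hn : (e.bits num).length ≤ n) :
    (tokens V).eval n ⟨e.bits num, out, fml, len, cnt, gap, tmp, ovr, bad⟩ =
      ⟨[], ((e.bind σ).bits num').reverse ++ out, fml, len, cnt, gap, tmp, ovr, bad⟩ := by
  obtain ⟨k, hk, h⟩ := exists_rounds_tokens hV e
  obtain ⟨m, rfl⟩ := Nat.exists_eq_add_of_le (hk.trans hn)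
  have h' := h (m + 1) [] out
  rw [List.append_nil] at h'
  rw [tokens, eval, add_assoc, h']
  rfl

end Registers

end Prog

open Prog

/-- The literal that replaces a variable when the first variable is negated. -/
def flipVar (m m' : ℕ) : Fin m ⊕ Fin m' → BExpr (Fin m ⊕ Fin m')
  | .inl i => if (i : ℕ) = 0 then .not (.var (.inl i)) else .var (.inl i)
  | .inr j => .var (.inr j)

/-- The instance in which the first variable is negated. -/
def Inst₂.flip (I : Inst₂) : Inst₂ := ⟨I.m, I.m', I.pos, I.f.bind (flipVar I.m I.m')⟩

theorem bits_flipVar {m m' : ℕ} (hm : 0 < m) (v : Fin m ⊕ Fin m') :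
    (flipVar m m' v).bits (num₂ m m') =
      if num₂ m m' v = 0 then [false, true, false, false, false]
      else false :: false :: unary (num₂ m m' v) := by
  rcases v with i | j
  · by_cases h : (i : ℕ) = 0 <;> simp [flipVar, num₂, h, BExpr.bits, unary]
  · simp [flipVar, num₂, BExpr.bits, hm.ne']

theorem unary_succ (k : ℕ) : unary (k + 1) = true :: unary k := rfl

theorem num₂_lt {m m' : ℕ} (v : Fin m ⊕ Fin m') : num₂ m m' v < m + m' := by
  rcases v with i | j <;> simp only [num₂, Sum.elim_inl, Sum.elim_inr] <;> omega

/-- Reads the number of a variable and writes the literal that replaces it in `Inst₂.flip`. -/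
def flipVarProg : Prog := pop .inp fun o =>
  if o = some true then (emit [false, false, true]).seq copyUnary
  else emit [false, true, false, false, false]

theorem substitutes_flipVarProg {m m' n : ℕ} (hm : 0 < m) (hn : m + m' ≤ n) :
    flipVarProg.Substitutes n (num₂ m m') (flipVar m m') (num₂ m m') [] [] [] [] [] [] [] := by
  intro v inp out
  have hv := num₂_lt v
  rw [bits_flipVar hm, flipVarProg, eval_pop]
  cases hk : num₂ m m' v with
  | zero => simp [unary, eval_emit, Store.get, Store.set]
  | succ k =>
    simp [unary_succ, eval, eval_emit, eval_copyUnary (by omega : k ≤ n), Store.get, Store.set]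

theorem computable_flip :
    Nonempty (TM2ComputableInPolyTime (fun I : Inst₂ => I.code.1) (fun I : Inst₂ => I.code.1)
      Inst₂.flip) := by
  refine nonempty_computable_of_eval
    (copyUnary.seq (copyUnary.seq (tokens flipVarProg))) fun I => ?_
  have hlen : I.code.1.length = I.m + 1 + (I.m' + 1 + (I.f.bits (num₂ I.m I.m')).length) := by
    simp [Inst₂.code, unary, add_assoc, add_comm, add_left_comm]
  generalize I.code.1.length = n at hlen
  rw [Inst₂.code, eval, eval_copyUnary (by omega), eval, eval_copyUnary (by omega),
    eval_tokens (substitutes_flipVarProg I.pos (by omega)) (by omega)]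
  simp [Inst₂.code, Inst₂.flip]

/-- The instance with a new first variable `z` for the formula `¬ z ∨ f(x)`. -/
def Inst₁.guard (I : Inst₁) : Inst₁ :=
  ⟨I.m + 1, I.m.succ_pos, .or (.not (.var 0)) (I.f.bind fun i => .var i.succ)⟩

theorem substitutes_succ {m n : ℕ} (hn : m ≤ n) :
    ((emit [false, false, true]).seq copyUnary).Substitutes n (Fin.val : Fin m → ℕ)
      (fun i => .var i.succ) Fin.val [] [] [] [] [] [] [] := by
  intro i inp out
  rw [eval, eval_emit]
  refine (eval_copyUnary (by omega)).trans ?_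
  simp [BExpr.bits, unary_succ]

theorem computable_guard :
    Nonempty (TM2ComputableInPolyTime (fun I : Inst₁ => I.code.1) (fun I : Inst₁ => I.code.1)
      Inst₁.guard) := by
  refine nonempty_computable_of_eval ((emit [true]).seq (copyUnary.seq
    ((emit [true, true, false, true, false, false, false]).seq
      (tokens ((emit [false, false, true]).seq copyUnary))))) fun I => ?_
  have hlen : I.code.1.length = I.m + 1 + (I.f.bits Fin.val).length := by
    simp [Inst₁.code, unary, add_assoc, add_comm]
  generalize I.code.1.length = n at hlen
  rw [Inst₁.code, eval, eval_emit, eval]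
  simp only [Store.set]
  rw [eval_copyUnary (by omega), eval, eval_emit]
  simp only [Store.set]
  rw [eval_tokens (substitutes_succ (by omega)) (by omega)]
  simp [Inst₁.code, Inst₁.guard, BExpr.bits, unary, List.replicate_succ]

/-! ### The formula for the greatest solution -/

/-- The pairs `i < j` in terms of `m - 1 - i` and `j - i - 1`. -/
def pairsEquivSigma (m : ℕ) : Pairs m ≃ Σ a : Fin m, Fin a where
  toFun p := ⟨p.1.1.rev, ⟨p.1.2 - p.1.1 - 1, by have := p.2; rw [Fin.val_rev]; omega⟩⟩
  invFun q := ⟨(q.1.rev, ⟨q.1.rev + q.2 + 1, by rw [Fin.val_rev]; omega⟩), by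
    simp only [Fin.lt_def]; omega⟩
  left_inv p := by
    obtain ⟨⟨i, j⟩, h⟩ := p
    ext
    · simp
    · simp only [Fin.lt_def, Fin.rev_rev] at h ⊢
      omega
  right_inv q := by
    obtain ⟨a, b⟩ := q
    ext
    · simp
    · rw [Fin.heq_ext_iff (by simp)]
      simp only
      omega

/-- The numbering of the pairs `i < j` by decreasing `i`, then increasing `j`. -/
def pairIndex (m : ℕ) : Pairs m ≃ Fin (m * (m - 1) / 2) :=
  (pairsEquivSigma m).trans <| finSigmaFinEquiv.trans <| finCongr <| by
    rw [← Finset.sum_range_id, Finset.sum_range]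

theorem num₂_pairIndex {m : ℕ} (p : Pairs m) :
    num₂ m (m * (m - 1) / 2) (.inr (pairIndex m p)) = p.1.2 + (m - p.1.1).choose 2 := by
  obtain ⟨⟨i, j⟩, h : (i : ℕ) < j⟩ := p
  have hi : m - i = m - (i + 1) + 1 := by omega
  simp only [num₂, Sum.elim_inr, pairIndex, Equiv.trans_apply, finCongr_apply, Fin.val_cast,
    finSigmaFinEquiv_apply, pairsEquivSigma, Equiv.coe_fn_mk, Fin.val_castLE]
  rw [← Finset.sum_range fun k => k, Finset.sum_range_id, ← Nat.choose_two_right, Fin.val_rev, hi,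
    Nat.choose_succ_succ' _ 1, Nat.choose_one_right, one_add_one_eq_two]
  omega

/-- The expression that replaces the variable `v` in the `i`-th conjunct. Since it stands in
`x_i ∨ ¬ f(…)`, the variable `x_i` may be replaced by `¬ x_i` instead of `1`. -/
def splicedVar {m : ℕ} (i v : Fin m) : BExpr (Fin m ⊕ Fin (m * (m - 1) / 2)) :=
  if h : i < v then .var (.inr (pairIndex m ⟨(i, v), h⟩))
  else if v = i then .not (.var (.inl i)) else .var (.inl v)

/-- The conjunct `x_i ∨ ¬ f(x_1, …, x_{i-1}, 1, y_{i,i+1}, …, y_{i,m})`. -/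
def conjunct {m : ℕ} (f : BExpr (Fin m)) (i : Fin m) : BExpr (Fin m ⊕ Fin (m * (m - 1) / 2)) :=
  .or (.var (.inl i)) (.not (f.bind (splicedVar i)))

/-- The conjunction of the conjuncts for the indices in a list and of `f(x)`. -/
def conjunction {m : ℕ} (f : BExpr (Fin m)) (l : List (Fin m)) :
    BExpr (Fin m ⊕ Fin (m * (m - 1) / 2)) :=
  l.foldr (fun i g => .and (conjunct f i) g) (f.bind fun i => .var (.inl i))

/-- The instance for the greatest solution. -/
def Inst₁.greatest (I : Inst₁) : Inst₂ :=
  ⟨I.m, I.m * (I.m - 1) / 2, I.pos, conjunction I.f ((List.finRange I.m).map Fin.rev)⟩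

theorem BExpr.bits_bind_var {V W : Type} (g : V → W) (num : W → ℕ) (e : BExpr V) :
    (e.bind fun v => .var (g v)).bits num = e.bits fun v => num (g v) := by
  induction e <;> simp_all [bind, bits]

/-- The contribution of the `i`-th conjunct to the bits of the conjunction. -/
def conjunctBits {m : ℕ} (f : BExpr (Fin m)) (i : Fin m) : List Bool :=
  true :: false :: (conjunct f i).bits (num₂ m (m * (m - 1) / 2))

theorem bits_conjunction {m : ℕ} (f : BExpr (Fin m)) (l : List (Fin m)) :
    (conjunction f l).bits (num₂ m (m * (m - 1) / 2)) =
      l.flatMap (conjunctBits f) ++ f.bits Fin.val := by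
  induction l with
  | nil => simp [conjunction, BExpr.bits_bind_var, num₂]
  | cons i l ih =>
    simp only [conjunction, List.foldr_cons, BExpr.bits] at ih ⊢
    simp [ih, conjunctBits]

theorem bits_splicedVar {m : ℕ} (i v : Fin m) :
    (splicedVar i v).bits (num₂ m (m * (m - 1) / 2)) =
      if i < v then false :: false :: unary (v + (m - i).choose 2)
      else if v = i then false :: true :: false :: false :: unary i
      else false :: false :: unary v := by
  unfold splicedVar
  split_ifs with h h'
  · simp [BExpr.bits, num₂_pairIndex]
  · simp [BExpr.bits, num₂]
  · simp [BExpr.bits, num₂]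

namespace Prog

/-- Moves the leading ones of the input to the register `len`, and drops the symbol that follows
them; if there is none, this is recorded in `bad`. -/
def readOnes : Prog := loop .inp (· == some true) fun o =>
  o.elim (push .bad true) fun b => if b then push .len true else nop

/-- Moves a number in unary from the input to the output and, without the final zero, to the
register `len`. -/
def readLen : Prog := readOnes.seq <| (copy .len .out).seq (push .out false)

/-- Appends the number of the pairs to the code of a function of `m` variables. -/
def insertPairs : Prog :=
  readLen.seq <|
    (loop .len Option.isSome fun o => o.elim nop fun _ =>
      (copy .cnt .out).seq (push .cnt true)).seq <|
    (push .out false).seq (pour .inp .out)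

/-- With `1^i` in `len`, reads the number `k` of a variable and replaces `1^i` by `1^(i-k)` in
`len`, `1^(min i k)` in `tmp`, and `1^(k-i)` in `ovr`. If the number is incomplete, this is recorded
in `bad`. -/
def compare : Prog := loop .inp (· == some true) fun o =>
  o.elim (push .bad true) fun b =>
    if b then pop .len fun o => if o.isSome then push .tmp true else push .ovr true else nop

/-- Reads the number of a variable and writes the expression that replaces it in the `i`-th
conjunct, where `len` is `1^i` and the length of `gap` is the number of the pairs before those
that begin with `i`, plus `m - 1 - i`. -/
def spliceVar : Prog :=
  compare.seq <| pop .ovr fun o =>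
    if o.isSome then
      (emit [false, false]).seq <| (pour .tmp .len).seq <| (copy .len .out).seq <|
        (push .out true).seq <| (pour .ovr .out).seq <| (copy .gap .out).seq (push .out false)
    else pop .len fun o =>
      if o.isSome then
        (emit [false, false]).seq <| (pour₂ .tmp .len .out).seq <| (push .len true).seq <|
          push .out false
      else (emit [false, true, false, false]).seq <| (pour₂ .tmp .len .out).seq (push .out false)

/-- Writes the `i`-th conjunct, where `len` is `1^i`, and moves on to the preceding one. -/
def writeConjunct : Prog :=
  (copy .cnt .gap).seq <| (push .cnt true).seq <|
    (emit [true, false, true, true, false, false]).seq <| (copy .len .out).seq <|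
      (emit [false, false, true]).seq <| reload.seq (tokens spliceVar)

/-- Turns the code of `f` with the number of the pairs into the code of the formula for the greatest
solution. -/
def writeGreatest : Prog :=
  readLen.seq <| copyUnary.seq <| (pour .inp .tmp).seq <| (pour .tmp .fml).seq <|
    (loop .len Option.isSome fun o => o.elim nop fun _ => writeConjunct).seq (pour .fml .out)

variable {n : ℕ} {inp out fml len cnt gap tmp ovr bad : List Bool}

theorem eval_readOnes {k : ℕ} {s : List Bool} (hs : s.head? ≠ some true) (hk : k ≤ n) :
    readOnes.eval n ⟨.replicate k true ++ s, out, fml, len, cnt, gap, tmp, ovr, bad⟩ =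
      ⟨s.tail, out, fml, .replicate k true ++ len, cnt, gap, tmp, ovr,
        if s = [] then true :: bad else bad⟩ := by
  have h := rounds_ones (r := .inp) (c := (· == some true)) (s := s)
    (g := fun o => (o.elim (push .bad true) fun b => if b then push .len true else nop).eval n)
    (F := fun i s => ⟨s, out, fml, .replicate i true ++ len, cnt, gap, tmp, ovr, bad⟩)
    (fun _ _ => rfl) (fun _ _ _ => rfl) rfl (by simpa using hs) (fun _ _ _ => rfl) hk
  rcases s with _ | ⟨_ | _, s⟩
  · simpa [readOnes, eval, Store.set, Store.get] using h
  · simpa [readOnes, eval, Store.set, Store.get] using h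
  · simp at hs

theorem eval_readLen {k : ℕ} (hk : k ≤ n) :
    readLen.eval n ⟨unary k ++ inp, out, fml, [], cnt, gap, [], ovr, bad⟩ =
      ⟨inp, (unary k).reverse ++ out, fml, .replicate k true, cnt, gap, [], ovr, bad⟩ := by
  rw [readLen, eval, unary, List.append_assoc, eval_readOnes (by simp) hk, eval,
    eval_copy (by decide) (by decide) (by decide) rfl (by simpa [Store.get] using hk)]
  simp [eval, Store.get, Store.set]

theorem eval_insertPairs_loop {m : ℕ} (hm : m ≤ n) :
    (loop .len Option.isSome fun o => o.elim nop fun _ =>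
      (copy .cnt .out).seq (push .cnt true)).eval n
        ⟨inp, out, fml, .replicate m true, [], gap, [], ovr, bad⟩ =
      ⟨inp, .replicate (m * (m - 1) / 2) true ++ out, fml, [], .replicate m true, gap, [], ovr,
        bad⟩ := by
  have h := rounds_ones (r := .len) (c := Option.isSome) (s := []) (k := m)
    (g := fun o => (o.elim nop fun _ => (copy .cnt .out).seq (push .cnt true)).eval n)
    (F := fun i s =>
      ⟨inp, .replicate (i.choose 2) true ++ out, fml, s, .replicate i true, gap, [], ovr, bad⟩)
    (fun _ _ => rfl) (fun _ _ _ => rfl) rfl rfl (fun i j hij => ?_) hm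
  · simpa [eval, Nat.choose_two_right] using h
  · have hout : List.replicate ((i + 1).choose 2) true ++ out =
        .replicate i true ++ (.replicate (i.choose 2) true ++ out) := by
      rw [← List.append_assoc, List.replicate_append_replicate, Nat.choose_succ_succ' i 1,
        Nat.choose_one_right]
    rw [hout, Option.elim, eval, eval_copy (by decide) (by decide) (by decide) rfl]
    · simp [eval, Store.get, Store.set, List.replicate_succ]
    · rw [Store.get, List.length_replicate]
      omega

theorem eval_insertPairs {m : ℕ} (hn : m + inp.length ≤ n) :
    (insertPairs.eval n { inp := unary m ++ inp }).out.reverse =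
      unary m ++ (unary (m * (m - 1) / 2) ++ inp) := by
  rw [insertPairs, eval, eval_readLen (by omega), eval, eval_insertPairs_loop (by omega), eval,
    eval_pour (by decide) (show inp.length ≤ n by omega)]
  simp [eval, Store.get, Store.set, unary]

theorem eval_compare {i k : ℕ} {s : List Bool} (hs : s.head? ≠ some true) (hk : k ≤ n) :
    compare.eval n
        ⟨.replicate k true ++ s, out, fml, .replicate i true, cnt, gap, [], [], bad⟩ =
      ⟨s.tail, out, fml, .replicate (i - k) true, cnt, gap, .replicate (min i k) true,
        .replicate (k - i) true, if s = [] then true :: bad else bad⟩ := by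
  have h := rounds_ones (r := .inp) (c := (· == some true)) (s := s)
    (g := fun o => (o.elim (push .bad true) fun b => if b then
      pop .len fun o => if o.isSome then push .tmp true else push .ovr true else nop).eval n)
    (F := fun x s => ⟨s, out, fml, .replicate (i - x) true, cnt, gap, .replicate (min i x) true,
      .replicate (x - i) true, bad⟩)
    (fun _ _ => rfl) (fun _ _ _ => rfl) rfl (by simpa using hs) (fun x j _ => ?_) hk
  · rcases s with _ | ⟨_ | _, s⟩
    · simpa [compare, eval, Store.set, Store.get] using h
    · simpa [compare, eval, Store.set, Store.get] using h
    · simp at hs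
  · rcases lt_or_ge x i with hx | hx
    · have hi : i - x = i - (x + 1) + 1 := by omega
      simp [eval, eval_pop, Store.get, Store.set, hi, hx.le, Nat.succ_le_of_lt hx,
        List.replicate_succ, Nat.sub_eq_zero_of_le]
    · have hi : x + 1 - i = x - i + 1 := by omega
      simp [eval, eval_pop, Store.get, Store.set, hi, hx, hx.trans x.le_succ, List.replicate_succ,
        Nat.sub_eq_zero_of_le]

theorem substitutes_spliceVar {m : ℕ} (i : Fin m) (hm : m ≤ n) (hn : (m - i).choose 2 ≤ n) :
    spliceVar.Substitutes n Fin.val (splicedVar i) (num₂ m (m * (m - 1) / 2)) fml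
      (.replicate i true) cnt (.replicate ((m - i).choose 2) true) [] [] [] := by
  intro v inp out
  rw [bits_splicedVar, spliceVar, eval, unary, List.append_assoc,
    eval_compare (by simp) (by omega), eval_pop]
  rcases lt_trichotomy i v with h | rfl | h
  · obtain ⟨d, hd⟩ := Nat.exists_eq_add_of_lt h
    have hv : List.replicate (v + (m - i).choose 2) true =
        .replicate i true ++ true :: .replicate (d + (m - i).choose 2) true := by
      rw [← List.replicate_succ, List.replicate_append_replicate, hd]
      congr 1
      omega
    have hcat (s : List Bool) : List.replicate ((m - i).choose 2) true ++ (.replicate d true ++ s) =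
        .replicate (d + (m - i).choose 2) true ++ s := by
      rw [← List.append_assoc, List.replicate_append_replicate, Nat.add_comm d]
    have hi : (i : ℕ) ≤ n := by omega
    have hdn : d ≤ n := by omega
    rw [min_eq_left (Fin.le_def.1 h.le), Nat.sub_eq_zero_of_le h.le,
      show (v - i : ℕ) = d + 1 by omega]
    simp (disch := first | decide | rfl | simp [Store.get, hi, hdn, hn]; done) [eval, eval_emit,
      eval_pour, eval_copy, Store.get, Store.set, unary, List.replicate_succ, h, hv, hcat]
  · have hi : (i : ℕ) ≤ n := by omega
    simp (disch := first | decide | simp [Store.get, hi]; done) [eval, eval_emit, eval_pop,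
      eval_pour₂, Store.get, Store.set, unary]
  · obtain ⟨d, hd⟩ := Nat.exists_eq_add_of_lt h
    have hv : (v : ℕ) ≤ n := by omega
    have hi : true :: List.replicate (v + d) true = .replicate i true := by
      rw [← List.replicate_succ, hd]
    rw [min_eq_right (Fin.le_def.1 h.le), Nat.sub_eq_zero_of_le h.le,
      show (i - v : ℕ) = d + 1 by omega]
    simp (disch := first | decide | simp [Store.get, hv]; done) [eval, eval_emit, eval_pop,
      eval_pour₂, Store.get, Store.set, List.replicate_succ, h.not_gt, h.ne, hi]

theorem eval_writeConjunct {m : ℕ} {f : BExpr (Fin m)} (i : Fin m) (hm : m ≤ n)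
    (hn : m * (m - 1) / 2 ≤ n) (hf : (f.bits Fin.val).length ≤ n) :
    writeConjunct.eval n ⟨[], out, f.bits Fin.val, .replicate i true, .replicate (m - i - 1) true,
        .replicate ((m - i - 1).choose 2) true, [], [], []⟩ =
      ⟨[], (conjunctBits f i).reverse ++ out, f.bits Fin.val, .replicate i true,
        .replicate (m - i) true, .replicate ((m - i).choose 2) true, [], [], []⟩ := by
  have hi : m - i = m - i - 1 + 1 := by omega
  have hgap : List.replicate (m - i - 1) true ++ .replicate ((m - i - 1).choose 2) true =
      .replicate ((m - i).choose 2) true := by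
    rw [hi, Nat.choose_succ_succ' _ 1, Nat.choose_one_right, List.replicate_append_replicate]
    rfl
  have hchoose : (m - i).choose 2 ≤ n :=
    (Nat.choose_le_choose 2 (Nat.sub_le m i)).trans (Nat.choose_two_right m ▸ hn)
  rw [writeConjunct, eval, eval_copy (by decide) (by decide) (by decide) rfl
    (by simp only [Store.get, List.length_replicate]; omega)]
  simp only [eval, eval_emit, Store.get, Store.set, List.reverse_replicate, hgap]
  rw [eval_copy (by decide) (by decide) (by decide) rfl
    (by simp only [Store.get, List.length_replicate]; omega)]
  simp only [Store.get, Store.set]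
  rw [eval_reload hf, List.append_nil, ← List.replicate_succ, ← hi,
    eval_tokens (substitutes_spliceVar i hm hchoose) hf]
  simp [conjunctBits, conjunct, BExpr.bits, num₂, unary]

theorem eval_writeConjuncts {m : ℕ} {f : BExpr (Fin m)} (hm : m ≤ n) (hn : m * (m - 1) / 2 ≤ n)
    (hf : (f.bits Fin.val).length ≤ n) :
    (loop .len Option.isSome fun o => o.elim nop fun _ => writeConjunct).eval n
        ⟨[], out, f.bits Fin.val, .replicate m true, [], [], [], [], []⟩ =
      ⟨[], (((List.finRange m).map Fin.rev).flatMap (conjunctBits f)).reverse ++ out,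
        f.bits Fin.val, [], .replicate m true, .replicate (m.choose 2) true, [], [], []⟩ := by
  have h := rounds_ones (r := .len) (c := Option.isSome) (s := []) (k := m)
    (g := fun o => (o.elim nop fun _ => writeConjunct).eval n)
    (F := fun x s =>
      ⟨[], ((((List.finRange m).map Fin.rev).take x).flatMap (conjunctBits f)).reverse ++ out,
        f.bits Fin.val, s, .replicate x true, .replicate (x.choose 2) true, [], [], []⟩)
    (fun _ _ => rfl) (fun _ _ _ => rfl) rfl rfl (fun x j hx => ?_) hm
  · simpa [eval, List.take_of_length_le] using h
  · have htake : ((List.finRange m).map Fin.rev).take (x + 1) =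
        ((List.finRange m).map Fin.rev).take x ++ [⟨j, by omega⟩] := by
      have hj : Fin.rev ⟨x, by omega⟩ = (⟨j, by omega⟩ : Fin m) := by
        ext
        simp only [Fin.val_rev]
        omega
      rw [List.take_succ_eq_append_getElem (by simp; omega)]
      simp [hj]
    have hwrite := eval_writeConjunct
      (out := ((((List.finRange m).map Fin.rev).take x).flatMap (conjunctBits f)).reverse ++ out)
      ⟨j, by omega⟩ hm hn hf
    rw [show m - j - 1 = x by omega, show m - j = x + 1 by omega] at hwrite
    simpa [htake] using hwrite

theorem eval_writeGreatest {m : ℕ} (hm : 0 < m) {f : BExpr (Fin m)}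
    (hn : m + (m * (m - 1) / 2 + (f.bits Fin.val).length) ≤ n) :
    (writeGreatest.eval n
      { inp := unary m ++ (unary (m * (m - 1) / 2) ++ f.bits Fin.val) }).out.reverse =
      (Inst₁.greatest ⟨m, hm, f⟩).code.1 := by
  rw [writeGreatest, eval, eval_readLen (by omega), eval, eval_copyUnary (by omega), eval,
    eval_pour (by decide) (by simp only [Store.get]; omega), eval,
    eval_pour (by decide) (by simp only [Store.get, Store.set, List.length_append,
      List.length_reverse, List.length_nil]; omega), eval]
  simp only [Store.get, Store.set, List.append_nil, List.reverse_reverse]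
  rw [eval_writeConjuncts (by omega) (by omega) (by omega),
    eval_pour (by decide) (by simp only [Store.get]; omega)]
  simp [Store.get, Store.set, Inst₁.greatest, Inst₂.code, bits_conjunction]

end Prog

theorem computable_greatest :
    Nonempty (TM2ComputableInPolyTime (fun I : Inst₁ => I.code.1) (fun I : Inst₂ => I.code.1)
      Inst₁.greatest) := by
  have hpairs : Nonempty (TM2ComputableInPolyTime (fun I : Inst₁ => I.code.1)
      (fun I : Inst₁ => unary I.m ++ (unary (I.m * (I.m - 1) / 2) ++ I.f.bits Fin.val)) id) :=
    nonempty_computable_of_eval insertPairs fun I =>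
      eval_insertPairs (by simp [Inst₁.code, unary])
  have hwrite : Nonempty (TM2ComputableInPolyTime
      (fun I : Inst₁ => unary I.m ++ (unary (I.m * (I.m - 1) / 2) ++ I.f.bits Fin.val))
      (fun I : Inst₂ => I.code.1) Inst₁.greatest) :=
    nonempty_computable_of_eval writeGreatest fun I => eval_writeGreatest I.pos (by
      simp only [unary, List.length_append, List.length_replicate]
      omega)
  exact hpairs.elim fun c => hwrite.elim fun c' => nonempty_computable_comp c c'

/-! ### Recognition of codes -/

/-- The string `s` is a sequence of `d` expressions in variables with numbers less than `B`. -/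
inductive Codes (B : ℕ) : ℕ → List Bool → Prop
  | nil : Codes B 0 []
  | var {d j s} : j < B → Codes B d s → Codes B (d + 1) (false :: false :: (unary j ++ s))
  | not {d s} : Codes B (d + 1) s → Codes B (d + 1) (false :: true :: s)
  | bin {d b s} : Codes B (d + 2) s → Codes B (d + 1) (true :: b :: s)

theorem exists_eq_replicate_append (s : List Bool) :
    ∃ k t, s = .replicate k true ++ t ∧ t.head? ≠ some true := by
  induction s with
  | nil => exact ⟨0, [], rfl, by simp⟩
  | cons b s ih =>
    cases b with
    | false => exact ⟨0, _, rfl, by simp⟩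
    | true =>
      obtain ⟨k, t, rfl, ht⟩ := ih
      exact ⟨k + 1, t, rfl, ht⟩

theorem replicate_append_eq_unary_append {k m : ℕ} {s t : List Bool} (ht : t.head? ≠ some true) :
    .replicate k true ++ t = unary m ++ s ↔ k = m ∧ t = false :: s := by
  constructor
  · intro h
    rcases t with _ | ⟨_ | _, t⟩
    · have hmem : false ∈ List.replicate k true := by
        rw [← List.append_nil (List.replicate k true), h]
        simp [unary]
      simp at hmem
    · obtain ⟨rfl, rfl⟩ := unary_append_inj (k := k) (s := t) (l := m) (t := s)
        (by simpa [unary] using h)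
      exact ⟨rfl, rfl⟩
    · simp at ht
  · rintro ⟨rfl, rfl⟩
    simp [unary]

section Codes

variable {B d : ℕ} {s : List Bool}

theorem codes_nil : Codes B d [] ↔ d = 0 := by
  constructor
  · rintro ⟨⟩
    rfl
  · rintro rfl
    exact .nil

theorem not_codes_zero {b : Bool} : ¬ Codes B 0 (b :: s) := by
  rintro ⟨⟩

theorem not_codes_singleton {b : Bool} : ¬ Codes B (d + 1) [b] := by
  rintro ⟨⟩

theorem codes_bin {b : Bool} : Codes B (d + 1) (true :: b :: s) ↔ Codes B (d + 2) s := by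
  constructor
  · rintro (_ | _ | _ | h)
    exact h
  · exact .bin

theorem codes_not : Codes B (d + 1) (false :: true :: s) ↔ Codes B (d + 1) s := by
  constructor
  · rintro (_ | _ | h)
    exact h
  · exact .not

theorem codes_var {k : ℕ} (hs : s.head? ≠ some true) :
    Codes B (d + 1) (false :: false :: (.replicate k true ++ s)) ↔
      s ≠ [] ∧ k < B ∧ Codes B d s.tail := by
  constructor
  · intro h
    generalize ht : List.replicate k true ++ s = t at h
    rcases h with _ | ⟨hj, h⟩
    obtain ⟨rfl, rfl⟩ := (replicate_append_eq_unary_append hs).1 ht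
    exact ⟨by simp, hj, h⟩
  · rcases s with _ | ⟨_ | _, s⟩
    · simp
    · rintro ⟨-, hk, h⟩
      simpa [unary] using h.var hk
    · simp at hs

theorem Codes.bits_append {V : Type} {num : V → ℕ} (hnum : ∀ v, num v < B) (e : BExpr V)
    (h : Codes B d s) : Codes B (d + 1) (e.bits num ++ s) := by
  induction e generalizing d s with
  | var v => exact .var (hnum v) h
  | not e ih => exact .not (ih h)
  | and e₁ e₂ ih₁ ih₂ | or e₁ e₂ ih₁ ih₂ =>
    simpa [BExpr.bits] using Codes.bin (ih₁ (ih₂ h))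

theorem Codes.exists_eq_flatMap_bits {V : Type} {num : V → ℕ} (hnum : ∀ j < B, ∃ v, num v = j)
    (h : Codes B d s) : ∃ es : List (BExpr V), es.length = d ∧ s = es.flatMap (BExpr.bits num) := by
  induction h with
  | nil => exact ⟨[], rfl, rfl⟩
  | var hj h ih =>
    obtain ⟨es, rfl, rfl⟩ := ih
    obtain ⟨v, rfl⟩ := hnum _ hj
    exact ⟨.var v :: es, rfl, by simp [BExpr.bits]⟩
  | not h ih =>
    obtain ⟨_ | ⟨e, es⟩, h₁, rfl⟩ := ih
    · cases h₁
    · exact ⟨.not e :: es, h₁, by simp [BExpr.bits]⟩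
  | @bin d b s h ih =>
    obtain ⟨_ | ⟨e₁, _ | ⟨e₂, es⟩⟩, h₁, rfl⟩ := ih
    · cases h₁
    · cases h₁
    · cases b with
      | false => exact ⟨.and e₁ e₂ :: es, by simpa using h₁, by simp [BExpr.bits]⟩
      | true => exact ⟨.or e₁ e₂ :: es, by simpa using h₁, by simp [BExpr.bits]⟩

theorem codes_one_iff {V : Type} {num : V → ℕ} (hnum : ∀ v, num v < B)
    (hnum' : ∀ j < B, ∃ v, num v = j) : Codes B 1 s ↔ ∃ e : BExpr V, s = e.bits num := by
  constructor
  · intro h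
    obtain ⟨es, h₁, rfl⟩ := h.exists_eq_flatMap_bits hnum'
    obtain ⟨e, rfl⟩ := List.length_eq_one_iff.1 h₁
    exact ⟨e, by simp⟩
  · rintro ⟨e, rfl⟩
    simpa using Codes.nil.bits_append hnum e

theorem exists_code₁_eq_iff : (∃ I : Inst₁, I.code.1 = s) ↔
    ∃ m, 0 < m ∧ ∃ t, s = unary m ++ t ∧ Codes m 1 t := by
  constructor
  · rintro ⟨⟨m, hm, f⟩, rfl⟩
    exact ⟨m, hm, _, rfl, (codes_one_iff Fin.is_lt fun j hj => ⟨⟨j, hj⟩, rfl⟩).2 ⟨f, rfl⟩⟩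
  · rintro ⟨m, hm, t, rfl, ht⟩
    obtain ⟨f, rfl⟩ := (codes_one_iff Fin.is_lt fun j hj => ⟨⟨j, hj⟩, rfl⟩).1 ht
    exact ⟨⟨m, hm, f⟩, rfl⟩

theorem exists_num₂_eq {m m' j : ℕ} (hj : j < m + m') : ∃ v, num₂ m m' v = j := by
  by_cases h : j < m
  · exact ⟨.inl ⟨j, h⟩, rfl⟩
  · exact ⟨.inr ⟨j - m, by omega⟩, by simp [num₂]; omega⟩

theorem exists_code₂_eq_iff : (∃ I : Inst₂, I.code.1 = s) ↔
    ∃ m, 0 < m ∧ ∃ m' t, s = unary m ++ (unary m' ++ t) ∧ Codes (m + m') 1 t := by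
  constructor
  · rintro ⟨⟨m, m', hm, f⟩, rfl⟩
    exact ⟨m, hm, m', _, rfl, (codes_one_iff num₂_lt fun j => exists_num₂_eq).2 ⟨f, rfl⟩⟩
  · rintro ⟨m, hm, m', t, rfl, ht⟩
    obtain ⟨f, rfl⟩ := (codes_one_iff (V := Fin m ⊕ Fin m') num₂_lt fun j => exists_num₂_eq).1 ht
    exact ⟨⟨m, m', hm, f⟩, rfl⟩

end Codes

namespace Prog

/-- Records in `bad` whether the register `r` is empty. -/
def demand (r : Reg) : Prog :=
  pop r fun o => if o.isSome then push r true else push .bad true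

/-- Reads the number of a variable and records in `bad` whether it is complete and less than the
number of ones in `len`. -/
def checkVar : Prog := compare.seq <| (demand .len).seq <| (pour .tmp .len).seq (clear .ovr)

/-- Reads the rest of a token beginning with `b`, where the number of ones in `cnt` is the number of
the expressions that are still to come. -/
def checkToken (b : Bool) : Prog :=
  pop .cnt fun o => if o.isNone then push .bad true else
    pop .inp fun o => o.elim (push .bad true) fun b' =>
      if b then (push .cnt true).seq (push .cnt true)
      else if b' then push .cnt true else checkVar

/-- Reads the remaining expressions. -/
def checkTokens : Prog := loop .inp Option.isSome fun o => o.elim nop checkToken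

/-- Writes the input if it is a code, where `H` reads the numbers with which a code begins, and
writes `w` otherwise. -/
def keepCode (H : Prog) (w : List Bool) : Prog :=
  (pour .inp .tmp).seq <| (pour₂ .tmp .fml .inp).seq <| H.seq <| (push .cnt true).seq <|
    checkTokens.seq <| pop .bad fun o => if o.isSome then emit w else
      pop .cnt fun o => if o.isSome then emit w else pour .fml .out

variable {n : ℕ} {inp out fml len cnt gap tmp ovr bad : List Bool}

theorem eval_demand_len {k : ℕ} :
    (demand .len).eval n ⟨inp, out, fml, .replicate k true, cnt, gap, tmp, ovr, bad⟩ =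
      ⟨inp, out, fml, .replicate k true, cnt, gap, tmp, ovr,
        if k = 0 then true :: bad else bad⟩ := by
  cases k <;> simp [demand, eval_pop, eval, Store.get, Store.set, List.replicate_succ]

theorem eval_checkVar {B k : ℕ} {s : List Bool} (hs : s.head? ≠ some true) (hk : k ≤ n) :
    ∃ bad', checkVar.eval n
        ⟨.replicate k true ++ s, out, fml, .replicate B true, cnt, gap, [], [], bad⟩ =
      ⟨s.tail, out, fml, .replicate B true, cnt, gap, [], [], bad'⟩ ∧
        (bad' = [] ↔ bad = [] ∧ s ≠ [] ∧ k < B) := by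
  have hB : min B k + (B - k) = B := by omega
  refine ⟨if B - k = 0 then true :: (if s = [] then true :: bad else bad) else
    if s = [] then true :: bad else bad, ?_, ?_⟩
  · rw [checkVar, eval, eval_compare hs hk, eval, eval_demand_len, eval,
      eval_pour (by decide) (by simp [Store.get, hk])]
    simp only [eval, Store.get, Store.set, List.reverse_replicate, List.replicate_append_replicate,
      hB]
  · split_ifs <;> simp <;> grind

/-- The registers while an expression is read. -/
def checking (s out fml : List Bool) (B d : ℕ) (bad : List Bool) : Store :=
  ⟨s, out, fml, .replicate B true, .replicate d true, [], [], [], bad⟩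

theorem eval_checkToken {B d : ℕ} {b : Bool} {s : List Bool} (hn : s.length ≤ n) :
    ∃ s' d' bad', s'.length ≤ s.length ∧
      (checkToken b).eval n (checking s out fml B d bad) = checking s' out fml B d' bad' ∧
      (bad' = [] ∧ Codes B d' s' ↔ bad = [] ∧ Codes B d (b :: s)) := by
  rcases d with _ | d
  · exact ⟨s, 0, true :: bad, le_rfl, rfl, by simp [not_codes_zero]⟩
  rcases s with _ | ⟨b', s⟩
  · exact ⟨[], d, true :: bad, le_rfl, rfl, by simp [not_codes_singleton]⟩
  rcases b with _ | _
  · rcases b' with _ | _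
    · obtain ⟨k, t, rfl, ht⟩ := exists_eq_replicate_append s
      have hk : k ≤ n := by simp at hn; omega
      obtain ⟨bad', h, hbad⟩ := eval_checkVar (out := out) (fml := fml) (B := B)
        (cnt := .replicate d true) (gap := []) (bad := bad) ht hk
      refine ⟨t.tail, d, bad', by simp; omega, h, ?_⟩
      rw [hbad, codes_var ht]
      tauto
    · exact ⟨s, d + 1, bad, s.length.le_succ, rfl, by rw [codes_not]⟩
  · exact ⟨s, d + 2, bad, s.length.le_succ, rfl, by rw [codes_bin]⟩

theorem eval_checkTokens {B d : ℕ} {s : List Bool} (hn : s.length ≤ n) :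
    ∃ d' bad', checkTokens.eval n (checking s out fml B d bad) = checking [] out fml B d' bad' ∧
      (bad' = [] ∧ d' = 0 ↔ bad = [] ∧ Codes B d s) := by
  have h (m : ℕ) : ∀ s d bad, s.length ≤ m → m ≤ n → ∃ d' bad',
      rounds .inp Option.isSome (fun o => (o.elim nop checkToken).eval n) (m + 1)
        (checking s out fml B d bad) = checking [] out fml B d' bad' ∧
      (bad' = [] ∧ d' = 0 ↔ bad = [] ∧ Codes B d s) := by
    induction m with
    | zero =>
      intro s d bad hs _
      obtain rfl := List.length_eq_zero_iff.1 (Nat.le_zero.1 hs)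
      exact ⟨d, bad, rfl, by rw [codes_nil]⟩
    | succ m ih =>
      rintro (_ | ⟨b, s⟩) d bad hs hm
      · exact ⟨d, bad, rfl, by rw [codes_nil]⟩
      · rw [List.length_cons, Nat.add_le_add_iff_right] at hs
        obtain ⟨s', d', bad', hs', htoken, hbad'⟩ := eval_checkToken (out := out) (fml := fml)
          (B := B) (d := d) (b := b) (bad := bad) (by omega : s.length ≤ n)
        obtain ⟨d'', bad'', hrounds, hbad''⟩ := ih s' d' bad' (by omega) (by omega)
        exact ⟨d'', bad'', (congrArg (rounds _ _ _ (m + 1)) htoken).trans hrounds,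
          hbad''.trans hbad'⟩
  exact h n s d bad hn le_rfl

end Prog

/-- `H` reads the numbers with which a code begins. -/
def ReadsHeader {ι : Type} (H : Prog) (code : ι → Str) : Prop :=
  ∀ n s, s.length ≤ n → ∃ s' B bad, s'.length ≤ n ∧
    H.eval n ⟨s, [], s, [], [], [], [], [], []⟩ = checking s' [] s B 0 bad ∧
    (bad = [] ∧ Codes B 1 s' ↔ ∃ I, (code I).1 = s)

theorem eval_keepCode {ι : Type} {H : Prog} {code : ι → Str} (hH : ReadsHeader H code)
    (w s : List Bool) [Decidable (∃ I, (code I).1 = s)] :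
    ((keepCode H w).eval s.length { inp := s }).out.reverse =
      if ∃ I, (code I).1 = s then s else w := by
  obtain ⟨s', B, bad, hs', hheader, hcode⟩ := hH s.length s le_rfl
  obtain ⟨d, bad', htokens, hbad'⟩ := eval_checkTokens (out := []) (fml := s) (B := B) (d := 1)
    (bad := bad) hs'
  have hstart : (pour₂ .tmp .fml .inp).eval s.length ((pour .inp .tmp).eval s.length { inp := s }) =
      ⟨s, [], s, [], [], [], [], [], []⟩ := by
    rw [eval_pour (by decide) (show (Store.get { inp := s } .inp).length ≤ s.length from le_rfl),
      eval_pour₂ (by decide) (by decide) (by decide) (by simp [Store.get, Store.set])]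
    simp [Store.get, Store.set]
  have hpush : (push .cnt true).eval s.length (checking s' [] s B 0 bad) =
      checking s' [] s B 1 bad := rfl
  rw [keepCode, eval, eval, hstart, eval, hheader, eval, hpush, eval, htokens, eval_pop]
  simp only [← hcode, ← hbad']
  rcases bad' with _ | ⟨b, bad'⟩
  · rcases d with _ | d
    · have hpour := eval_pour (r := .fml) (r' := .out) (by decide)
        (show (Store.get { fml := s, len := .replicate B true } .fml).length ≤ s.length from le_rfl)
      simp [checking, Store.get, Store.set, eval_pop, hpour]
    · simp [checking, Store.get, Store.set, eval_pop, eval_emit, List.replicate_succ]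
  · simp [checking, Store.get, Store.set, eval_emit]

theorem readsHeader_code₁ : ReadsHeader (readOnes.seq (demand .len)) Inst₁.code := by
  intro n s hn
  obtain ⟨m, t, rfl, ht⟩ := exists_eq_replicate_append s
  simp only [List.length_append, List.length_replicate] at hn
  refine ⟨t.tail, m, if m = 0 then true :: (if t = [] then [true] else []) else
    if t = [] then [true] else [], by simp; omega, ?_, ?_⟩
  · rw [eval, eval_readOnes ht (by omega), List.append_nil, eval_demand_len]
    rfl
  · simp only [exists_code₁_eq_iff, replicate_append_eq_unary_append ht]
    rcases t with _ | ⟨_ | _, t⟩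
    · simp [codes_nil]
    · split_ifs <;> simp <;> grind
    · simp at ht

theorem readsHeader_code₂ :
    ReadsHeader ((readOnes.seq (demand .len)).seq readOnes) Inst₂.code := by
  intro n s hn
  obtain ⟨m, t, rfl, ht⟩ := exists_eq_replicate_append s
  obtain ⟨m', t', htail, ht'⟩ := exists_eq_replicate_append t.tail
  have hlen : t.tail.length ≤ t.length := by simp
  simp only [htail, List.length_append, List.length_replicate] at hn hlen
  let bad := if m = 0 then true :: (if t = [] then [true] else []) else
    if t = [] then [true] else []
  refine ⟨t'.tail, m + m', if t' = [] then true :: bad else bad, by simp; omega, ?_, ?_⟩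
  · rw [eval, eval, eval_readOnes ht (by omega), List.append_nil, eval_demand_len, htail,
      eval_readOnes ht' (by omega), List.replicate_append_replicate, add_comm m']
    rfl
  · have hbad : (if t' = [] then true :: bad else bad) = [] ↔ 0 < m ∧ t ≠ [] ∧ t' ≠ [] := by
      grind
    rw [hbad, exists_code₂_eq_iff]
    simp only [replicate_append_eq_unary_append ht]
    rcases t with _ | ⟨_ | _, t⟩
    · simp
    · obtain rfl : t = .replicate m' true ++ t' := htail
      simp only [List.cons.injEq, true_and, replicate_append_eq_unary_append ht']
      rcases t' with _ | ⟨_ | _, t'⟩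
      · simp
      · simp
      · simp at ht'
    · simp at ht

open Classical in
/-- The instance with a given code, or a default instance if there is none. -/
noncomputable def decode {ι : Type} (code : ι → Str) (I₀ : ι) (s : Str) : ι :=
  if h : ∃ I, code I = s then h.choose else I₀

section Decode

variable {ι : Type} {code : ι → Str}

theorem decode_code (hc : Function.Injective code) (I₀ I : ι) : decode code I₀ (code I) = I := by
  have h : ∃ J, code J = code I := ⟨I, rfl⟩
  rw [decode, dif_pos h]
  exact hc h.choose_spec

theorem decode_of_not_exists {I₀ : ι} {s : Str} (h : ¬ ∃ I, code I = s) : decode code I₀ s = I₀ :=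
  dif_neg h

open Classical in
theorem code_decode (code : ι → Str) (I₀ : ι) (s : Str) :
    (code (decode code I₀ s)).1 = if ∃ I, (code I).1 = s.1 then s.1 else (code I₀).1 := by
  simp only [← Subtype.ext_iff]
  by_cases h : ∃ I, code I = s
  · rw [if_pos h, decode, dif_pos h, h.choose_spec]
  · rw [if_neg h, decode_of_not_exists h]

theorem computable_decode {H : Prog} (hH : ReadsHeader H code) (I₀ : ι) :
    Nonempty (TM2ComputableInPolyTime (Subtype.val : Str → List Bool) (fun I => (code I).1)
      (decode code I₀)) :=
  nonempty_computable_of_eval (keepCode H (code I₀).1) fun s => by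
    classical rw [eval_keepCode hH, code_decode]

theorem polyTime_map {κ : Type} {code' : κ → Str} {H : Prog} (hH : ReadsHeader H code) (I₀ : ι)
    {f : ι → κ}
    (hf : Nonempty (TM2ComputableInPolyTime (fun I => (code I).1) (fun J => (code' J).1) f)) :
    PolyTime fun s => code' (f (decode code I₀ s)) :=
  (computable_decode hH I₀).elim fun c => hf.elim fun c' =>
    (nonempty_computable_comp c c').map fun c => ⟨c.toTM2ComputableAux, c.time, c.outputsFun⟩

end Decode

/-! ### Reductions -/

theorem StronglyReduces.trans {φ₁ φ₂ φ₃ : PromiseProblem} (h₁ : φ₁ ∝ φ₂) (h₂ : φ₂ ∝ φ₃) :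
    φ₁ ∝ φ₃ := by
  obtain ⟨μ₁, ⟨c₁⟩, h₁⟩ := h₁
  obtain ⟨μ₂, ⟨c₂⟩, h₂⟩ := h₂
  exact ⟨μ₂ ∘ μ₁, nonempty_computable_comp c₁ c₂, fun s => (h₂ (μ₁ s)).trans (h₁ s)⟩

theorem StronglyReduces.dual {φ₁ φ₂ : PromiseProblem} (h : φ₁ ∝ φ₂) :
    PromiseHierarchy.dual φ₁ ∝ PromiseHierarchy.dual φ₂ :=
  h.imp fun _ h => ⟨h.1, fun s => Set.image_mono (h.2 s)⟩

theorem Answers.neg_neg (S : Answers) : S.neg.neg = S :=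
  Subtype.ext <| by simp [Answers.neg, Set.image_image]

theorem neg_anyAnswer : anyAnswer.neg = anyAnswer :=
  Subtype.ext <| Set.image_univ_of_surjective Bool.involutive_not.surjective

theorem dual_dual (φ : PromiseProblem) : dual (dual φ) = φ := funext fun s => (φ s).neg_neg

theorem strongClosure_dual_eq {φ : PromiseProblem} (h : dual φ ∝ φ) :
    strongClosure (dual φ) = strongClosure φ := by
  have h' : φ ∝ dual φ := by simpa only [dual_dual] using h.dual
  exact Set.ext fun ψ => ⟨fun hψ => hψ.trans h, fun hψ => hψ.trans h'⟩

section Dual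

variable {m m' : ℕ}

theorem uval₂_comp_eq_neg (hm : 0 < m) (f : (Fin m → Bool) → (Fin m' → Bool) → Bool)
    {σ : (Fin m → Bool) → Fin m → Bool} (hσ : σ.Bijective)
    (h₀ : ∀ x, σ x ⟨0, hm⟩ = !x ⟨0, hm⟩) :
    uval₂ hm (fun x y => f (σ x) y) = (uval₂ hm f).neg := by
  have hu : (∃! x, ∀ y, f (σ x) y = true) ↔ ∃! x, ∀ y, f x y = true :=
    (hσ.existsUnique_iff (p := fun x => ∀ y, f x y = true)).symm
  ext b
  simp only [uval₂, promise, hu, Answers.neg, Set.mem_image, Set.mem_ofPred_eq]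
  constructor
  · refine fun h => ⟨!b, fun hp => ?_, b.not_not⟩
    obtain ⟨x, hx, rfl⟩ := h hp
    exact ⟨σ x, hx, h₀ x⟩
  · rintro ⟨b, hb, rfl⟩ hp
    obtain ⟨x, hx, rfl⟩ := hb hp
    obtain ⟨x, rfl⟩ := hσ.surjective x
    exact ⟨x, hx, by rw [h₀, Bool.not_not]⟩

theorem eval_bind_flipVar (hm : 0 < m) (f : BExpr (Fin m ⊕ Fin m')) (x : Fin m → Bool)
    (y : Fin m' → Bool) : (f.bind (flipVar m m')).eval (Sum.elim x y) =
      f.eval (Sum.elim (Function.update x ⟨0, hm⟩ (!x ⟨0, hm⟩)) y) := by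
  rw [BExpr.eval_bind]
  congr 1
  funext v
  rcases v with i | j
  · by_cases h : i = ⟨0, hm⟩
    · simp [h, flipVar, BExpr.eval]
    · have h' : (i : ℕ) ≠ 0 := fun h' => h (Fin.ext h')
      simp [flipVar, BExpr.eval, h, h']
  · simp [flipVar, BExpr.eval]

theorem uval₂_flip (I : Inst₂) :
    uval₂ I.flip.pos (fun x y => I.flip.f.eval (Sum.elim x y)) =
      (uval₂ I.pos fun x y => I.f.eval (Sum.elim x y)).neg := by
  obtain ⟨m, m', hm, f⟩ := I
  have hinv : Function.Involutive fun x : Fin m → Bool =>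
    Function.update x ⟨0, hm⟩ (!x ⟨0, hm⟩) := fun x => by simp
  simpa only [Inst₂.flip, eval_bind_flipVar hm] using
    uval₂_comp_eq_neg hm (fun x y => f.eval (Sum.elim x y)) hinv.bijective fun x => by simp

theorem dual_UVAL₂_reduces : dual UVAL₂ ∝ UVAL₂ := by
  refine ⟨_, polyTime_map readsHeader_code₂ ⟨1, 0, one_pos, .var (.inl 0)⟩ computable_flip,
    fun s => ?_⟩
  by_cases h : ∃ I, Inst₂.code I = s
  · obtain ⟨I, rfl⟩ := h
    rw [decode_code Inst₂.code_injective, UVAL₂_code, uval₂_flip, dual, UVAL₂_code]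
  · rw [dual, UVAL₂, Function.extend_apply' _ _ s h, neg_anyAnswer]
    exact Set.subset_univ _

end Dual

section Greatest

variable {m : ℕ}

theorem IsMaxSat.unique {f : (Fin m → Bool) → Bool} {x z : Fin m → Bool} (hx : IsMaxSat f x)
    (hz : IsMaxSat f z) : x = z :=
  toLex_inj.1 (IsGreatest.unique hx hz)

theorem maxVal_eq_onlyAnswer (hm : 0 < m) {f : (Fin m → Bool) → Bool} {x : Fin m → Bool}
    (hx : IsMaxSat f x) : maxVal hm f = onlyAnswer (x ⟨0, hm⟩) := by
  ext b
  simp only [maxVal, promise, onlyAnswer, Set.mem_ofPred_eq, Set.mem_singleton_iff]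
  constructor
  · intro h
    obtain ⟨z, hz, rfl⟩ := h ⟨x, hx.1⟩
    rw [hz.unique hx]
  · rintro rfl _
    exact ⟨x, hx, rfl⟩

theorem uval₂_eq_maxVal (hm : 0 < m) {m' : ℕ} {f : (Fin m → Bool) → Bool}
    {g : (Fin m → Bool) → (Fin m' → Bool) → Bool} (hsat : ∃ x, f x = true)
    (hg : ∀ x, (∀ y, g x y = true) ↔ IsMaxSat f x) : uval₂ hm g = maxVal hm f := by
  have hu : ∃! x, IsMaxSat f x :=
    (exists_isMaxSat hsat).imp fun x hx => ⟨hx, fun z hz => hz.unique hx⟩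
  simp only [uval₂, maxVal, hg, promise, hu, hsat]

theorem spliced_eq_of_forall_lt {x z : Fin m → Bool} {i : Fin m} (h : ∀ j < i, x j = z j)
    (hi : z i = true) : spliced x (fun p => z p.1.2) i = z := by
  funext j
  rcases lt_trichotomy i j with hij | rfl | hij
  · simp [spliced, hij]
  · simp [spliced, hi]
  · simp [spliced, hij.not_gt, hij.ne, h j hij]

theorem toLex_lt_toLex_spliced {x : Fin m → Bool} {i : Fin m} (hi : x i = false)
    (y : Pairs m → Bool) : toLex x < toLex (spliced x y i) :=
  ⟨i, fun j hj => by simp [spliced, hj.not_gt, hj.ne], by simp [spliced, hi]⟩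

theorem forall_maxFormula_iff (f : (Fin m → Bool) → Bool) (x : Fin m → Bool) :
    (∀ y, maxFormula f x y = true) ↔ IsMaxSat f x := by
  simp only [maxFormula, Bool.and_eq_true, decide_eq_true_eq, Bool.or_eq_true, Bool.not_eq_true']
  constructor
  · refine fun h => ⟨(h fun _ => true).1, fun z (hz : f (ofLex z) = true) => not_lt.1 ?_⟩
    rintro ⟨i, heq, hlt⟩
    obtain ⟨hxi, hzi⟩ := Bool.lt_iff.1 hlt
    have hi := (h fun p => ofLex z p.1.2).2 i
    rw [spliced_eq_of_forall_lt (x := x) (z := ofLex z) heq hzi, hz] at hi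
    exact hi.elim (fun hi => Bool.false_ne_true (hxi.symm.trans hi)) Bool.noConfusion
  · refine fun hx y => ⟨hx.1, fun i => ?_⟩
    by_contra! hi
    have hlt := toLex_lt_toLex_spliced (Bool.eq_false_of_not_eq_true hi.1) y
    exact hlt.not_ge (hx.2 (Bool.eq_true_of_not_eq_false hi.2))

theorem eval_conjunction (f : BExpr (Fin m)) (l : List (Fin m))
    (a : Fin m ⊕ Fin (m * (m - 1) / 2) → Bool) :
    (conjunction f l).eval a = true ↔
      f.eval (fun i => a (.inl i)) = true ∧ ∀ i ∈ l, (conjunct f i).eval a = true := by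
  induction l with
  | nil => simp [conjunction, BExpr.eval_bind, BExpr.eval]
  | cons i l ih =>
    rw [conjunction, List.foldr_cons, BExpr.eval, Bool.and_eq_true, ← conjunction, ih,
      List.forall_mem_cons]
    tauto

theorem eval_conjunct (f : BExpr (Fin m)) (i : Fin m) (x : Fin m → Bool)
    (y : Fin (m * (m - 1) / 2) → Bool) :
    (conjunct f i).eval (Sum.elim x y) = (x i || !(f.eval (spliced x (y ∘ pairIndex m) i))) := by
  simp only [conjunct, BExpr.eval, BExpr.eval_bind, Sum.elim_inl]
  cases hx : x i with
  | true => rfl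
  | false =>
    have h : (fun v => (splicedVar i v).eval (Sum.elim x y)) = spliced x (y ∘ pairIndex m) i := by
      funext v
      unfold splicedVar spliced
      split_ifs <;> simp [BExpr.eval, hx]
    rw [h]

theorem eval_greatest (f : BExpr (Fin m)) (x : Fin m → Bool) (y : Fin (m * (m - 1) / 2) → Bool) :
    (conjunction f ((List.finRange m).map Fin.rev)).eval (Sum.elim x y) =
      maxFormula f.eval x (y ∘ pairIndex m) := by
  have hmem (i : Fin m) : i ∈ (List.finRange m).map Fin.rev :=
    List.mem_map.2 ⟨i.rev, List.mem_finRange _, i.rev_rev⟩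
  rw [Bool.eq_iff_iff, eval_conjunction]
  simp only [eval_conjunct, maxFormula, Bool.and_eq_true, decide_eq_true_eq, Sum.elim_inl, hmem,
    true_imp_iff]

theorem forall_eval_greatest_iff (f : BExpr (Fin m)) (x : Fin m → Bool) :
    (∀ y : Fin (m * (m - 1) / 2) → Bool,
      (conjunction f ((List.finRange m).map Fin.rev)).eval (Sum.elim x y) = true) ↔
      IsMaxSat f.eval x := by
  simp only [eval_greatest, ← forall_maxFormula_iff]
  exact ((pairIndex m).symm.arrowCongr (.refl Bool)).forall_congr_right
    (q := fun y => maxFormula f.eval x y = true)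

theorem isStrongReduction_greatest (I₀ : Inst₁) : IsStrongReduction
    (fun s => (decode Inst₁.code I₀ s).greatest.code) MaxVAL UVAL₂ := by
  refine ⟨polyTime_map readsHeader_code₁ I₀ computable_greatest, fun s => ?_⟩
  by_cases h : ∃ I, Inst₁.code I = s
  · obtain ⟨I, rfl⟩ := h
    simp only [decode_code Inst₁.code_injective, UVAL₂_code, MaxVAL_code]
    by_cases hsat : ∃ x, I.f.eval x = true
    · exact (congrArg Subtype.val
        (uval₂_eq_maxVal I.pos hsat (forall_eval_greatest_iff I.f))).subset
    · exact fun b _ h => absurd h hsat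
  · rw [MaxVAL, Function.extend_apply' _ _ s h]
    exact Set.subset_univ _

end Greatest

theorem eval_guard (I : Inst₁) (x : Fin (I.m + 1) → Bool) :
    I.guard.f.eval x = (!x 0 || I.f.eval fun i => x i.succ) := by
  simp [Inst₁.guard, BExpr.eval, BExpr.eval_bind]

theorem IsMaxSat.guard_zero {I : Inst₁} {x : Fin (I.m + 1) → Bool}
    (hx : IsMaxSat I.guard.f.eval x) : x 0 = true ↔ ∃ z, I.f.eval z = true := by
  constructor
  · intro h
    have hx₁ : I.guard.f.eval x = true := hx.1
    exact ⟨_, by simpa [eval_guard, h] using hx₁⟩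
  · rintro ⟨z, hz⟩
    by_contra h
    have hle : toLex (Fin.cons true z : Fin (I.m + 1) → Bool) ≤ toLex x :=
      hx.2 ((eval_guard I (Fin.cons true z)).trans (by simpa using hz))
    exact hle.not_gt ⟨0, fun j hj => absurd hj j.not_lt_zero, by simpa [Bool.lt_iff] using h⟩

open Classical in
theorem maxVal_guard (I : Inst₁) : maxVal I.guard.pos I.guard.f.eval =
    onlyAnswer (decide (∃ x, I.f.eval x = true)) := by
  have hsat : ∃ x, I.guard.f.eval x = true := ⟨fun _ => false, eval_guard I _⟩
  obtain ⟨x, hx⟩ := exists_isMaxSat hsat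
  rw [maxVal_eq_onlyAnswer _ hx]
  exact congrArg onlyAnswer (Bool.eq_iff_iff.2 (hx.guard_zero.trans decide_eq_true_iff.symm))

theorem SAT_reduces_MaxVAL : SAT ∝ MaxVAL := by
  let I₀ : Inst₁ := ⟨1, one_pos, .and (.var 0) (.not (.var 0))⟩
  have hI₀ : ¬ ∃ x, I₀.f.eval x = true := by simp [I₀, BExpr.eval]
  refine ⟨_, polyTime_map readsHeader_code₁ I₀ computable_guard, fun s => ?_⟩
  rw [MaxVAL_code, maxVal_guard]
  by_cases h : ∃ I, Inst₁.code I = s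
  · obtain ⟨I, rfl⟩ := h
    rw [decode_code Inst₁.code_injective, SAT, Inst₁.code_injective.extend_apply]
  · rw [decode_of_not_exists h, SAT, Function.extend_apply' _ _ _ h, decide_eq_false hI₀]

end PromiseHierarchy

open PromiseHierarchy

theorem theorem2 :
    -- the class of problems reducible to `UVAL₂` is self-dual
    strongClosure (dual UVAL₂) = strongClosure UVAL₂ ∧
    -- `MaxVAL` strongly reduces to `UVAL₂`
    MaxVAL ∝ UVAL₂ ∧
    -- the reduction maps a code of `f(x)` to a code of the explicit `g(x, y)`, for which the only
    -- `x` with `g(x, y) = 1` for all `y` is the greatest satisfying assignment of `f`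
    (∃ μ : Str → Str, IsStrongReduction μ MaxVAL UVAL₂ ∧
      ∀ (m : ℕ) (hm : 0 < m), ∃ e : Pairs m ≃ Fin (m * (m - 1) / 2),
        ∀ f : BExpr (Fin m), ∃ g : BExpr (Fin m ⊕ Fin (m * (m - 1) / 2)),
          μ (Inst₁.code ⟨m, hm, f⟩) = Inst₂.code ⟨m, m * (m - 1) / 2, hm, g⟩ ∧
          (∀ (x : Fin m → Bool) (y : Fin (m * (m - 1) / 2) → Bool),
            g.eval (Sum.elim x y) = maxFormula f.eval x (y ∘ e)) ∧
          ∀ x : Fin m → Bool,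
            (∀ y : Fin (m * (m - 1) / 2) → Bool, g.eval (Sum.elim x y) = true) ↔
              IsMaxSat f.eval x) ∧
    -- hence `SAT` strongly reduces to `UVAL₂`
    SAT ∝ UVAL₂ := by
  have hred := isStrongReduction_greatest ⟨1, one_pos, .var 0⟩
  refine ⟨strongClosure_dual_eq dual_UVAL₂_reduces, ⟨_, hred⟩, ⟨_, hred, fun m hm =>
    ⟨pairIndex m, fun f => ⟨conjunction f ((List.finRange m).map Fin.rev), ?_, eval_greatest f,
      forall_eval_greatest_iff f⟩⟩⟩, SAT_reduces_MaxVAL.trans ⟨_, hred⟩⟩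
  rw [decode_code Inst₁.code_injective]
  rfl
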